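/- Let $r,m\ge 1$ and $n_1,\dots,n_r\ge 1$ be integers and put $n=\sum_{i=1}^r (n_i+1)$, $\mathbf r=r+2$. For $v\in\mathbb R^{p+1}$ write $v=(v_0,\bar v)$ with $v_0\in\mathbb R$, $\bar v\in\mathbb R^{p}$, and let $\mathcal L_p=\{v\in\mathbb R^{p+1}: v_0\ge\|\bar v\|\}$ be the Lorentz cone. Let $K=\mathcal L_{n_1}\times\dots\times\mathcal L_{n_r}\subset\mathbb R^n$ and $\mathcal K=K\times\mathcal L_n\times\mathcal L_m$; elements of the ambient space of $\mathcal K$ are written $\vec x=(x,t,x',\tau,x'')$ with $x=(x_1,\dots,x_r)$, $x_i\in\mathbb R^{n_i+1}$, $t,\tau\in\mathbb R$, $x'\in\mathbb R^n$, $x''\in\mathbb R^m$. Let $A=(A_1,\dots,A_r)\in\mathbb R^{m\times n}$, with $A_i\in\mathbb R^{m\times(n_i+1)}$, satisfy $\|A_i\|_F=1/\sqrt r$ for all $i$, and put $$\mathcal A=\begin{pmatrix}A&0&0&0&I_m\\-I_n&0&I_n&0&0\\0&1&0&0&0\end{pmatrix},\qquad \vec b=\begin{pmatrix}0\\0\\1\end{pmatrix},\qquad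 \vec c=(0,0,0,1,0)^{\mathrm T}.$$ Let $$f(\vec x)=-\Big(\sum_{i=1}^r\ln(x_{i0}^2-\|\bar x_i\|^2)+\ln(t^2-\|x'\|^2)+\ln(\tau^2-\|x''\|^2)\Big),$$ $g=\nabla f$, $H=\nabla^2 f$, and $\|u\|_{\vec x}=(u^{\mathrm T}H(\vec x)u)^{1/2}$. For $z=(\vec x,\vec y,\vec s)$ put $\mu(z)=\vec x^{\mathrm T}\vec s/(2\mathbf r)$, and for $\beta>0$ let $\mathcal N_\beta$ be the set of all $z=(\vec x,\vec y,\vec s)$ with $\vec x,\vec s\in\operatorname{int}\mathcal K$, $\vec y\in\mathbb R^{m+n+1}$ and $$\mathcal A\vec x=\vec b,\qquad \mathcal A^{\mathrm T}\vec y+\vec s=\vec c,\qquad \|\vec s+\mu(z)g(\vec x)\|_{-\mu(z)g(\vec x)}\le\beta .$$ **Lemma.** Let $\beta\in[1/60,1/15]$ and $\delta\in(0,1/2)$ be constants such that $$\frac{7(\beta^2+\delta^2)}{1-\beta}<\Big(1-\frac{\delta}{\sqrt{\mathbf r}}\Big)\beta$$ (for instance $\beta=1/15$, $\delta=1/45$).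 Let $z=(\vec x,\vec y,\vec s)\in\mathcal N_\beta$, write $\mu=\mu(z)$, let $w\in\operatorname{int}\mathcal K$ be the scaling point of $(\vec x,\vec s)$, that is, $H(w)\vec x=\vec s$, and let $\bar\mu=(1-\delta'/\sqrt{\mathbf r})\,\mu$ with $|\delta'-\delta|\le\delta/24$. Suppose that $\Delta z=(\Delta\vec x,\Delta\vec y,\Delta\vec s)$ and the residual vector $\varrho$ satisfy $$\mathcal A\Delta\vec x=0,\qquad \mathcal A^{\mathrm T}\Delta\vec y+\Delta\vec s=0,\qquad \Delta\vec x+H(w)^{-1}\Delta\vec s=-(\bar\mu\, g(\vec s)+\vec x)+\varrho,\qquad \|\varrho\|\le\frac{\mu}{120\,\mathbf r\,(2\mathbf r\mu+1)},$$ with the Euclidean norm on $\varrho$. Then $z^+=z+\Delta z$ satisfies $$z^+\in\mathcal N_\beta\qquad\text{and}\qquad |\mu(z^+)-\bar\mu|\le\frac{\mu}{120\,\mathbf r^2}.$$ -/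

import Mathlib

open scoped RealInnerProductSpace Matrix

noncomputable section

namespace ConicIPM

variable {r m : ℕ} {p : Fin r → ℕ}

/-- Coordinates of `ℝⁿ = ℝ^(p₁+1) × ⋯ × ℝ^(p_r+1)`, `n = ∑ᵢ (pᵢ + 1)`:
the pair `⟨i, j⟩` is coordinate `j ∈ {0, …, pᵢ}` of block `i`. -/
abbrev Idx (p : Fin r → ℕ) : Type := (i : Fin r) × Fin (p i + 1)

/-- The space `ℝⁿ` with its Euclidean norm. -/
abbrev Space (p : Fin r → ℕ) : Type := EuclideanSpace ℝ (Idx p)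

/-- Coordinates of the extended vectors `(x, t, x', τ, x'')`, `x, x' ∈ ℝⁿ`, `t, τ ∈ ℝ`,
`x'' ∈ ℝᵐ`. -/
abbrev ExtIdx (p : Fin r → ℕ) (m : ℕ) : Type :=
  Idx p ⊕ ((Unit ⊕ Idx p) ⊕ (Unit ⊕ Fin m))

/-- The space `ℝ^(2n+m+2)` of the extended vectors `(x, t, x', τ, x'')`. -/
abbrev ExtSpace (p : Fin r → ℕ) (m : ℕ) : Type := EuclideanSpace ℝ (ExtIdx p m)

/-- Coordinates of the multipliers `(y, y', -η)`, `y ∈ ℝᵐ`, `y' ∈ ℝⁿ`, `η ∈ ℝ`. -/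
abbrev DualIdx (p : Fin r → ℕ) (m : ℕ) : Type := Fin m ⊕ (Idx p ⊕ Unit)

/-- The space `ℝ^(m+n+1)` of the multipliers. -/
abbrev DualSpace (p : Fin r → ℕ) (m : ℕ) : Type := EuclideanSpace ℝ (DualIdx p m)

/-- The coordinate `x_{i0}` of block `i`. -/
def head (x : Space p) (i : Fin r) : ℝ := x ⟨i, 0⟩

/-- The vector `x̄ᵢ ∈ ℝ^(pᵢ)` of the remaining coordinates of block `i`. -/
def tail (x : Space p) (i : Fin r) : EuclideanSpace ℝ (Fin (p i)) :=
  WithLp.toLp 2 fun j => x ⟨i, j.succ⟩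

/-- The component `x` of `(x, t, x', τ, x'')`. -/
def partX (v : ExtSpace p m) : Space p :=
  WithLp.toLp 2 fun j => v (Sum.inl j)

/-- The component `t` of `(x, t, x', τ, x'')`. -/
def partT (v : ExtSpace p m) : ℝ := v (Sum.inr (Sum.inl (Sum.inl ())))

/-- The component `x'` of `(x, t, x', τ, x'')`. -/
def partX' (v : ExtSpace p m) : Space p :=
  WithLp.toLp 2 fun j => v (Sum.inr (Sum.inl (Sum.inr j)))

/-- The component `τ` of `(x, t, x', τ, x'')`. -/
def partTau (v : ExtSpace p m) : ℝ := v (Sum.inr (Sum.inr (Sum.inl ())))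

/-- The component `x''` of `(x, t, x', τ, x'')`. -/
def partX'' (v : ExtSpace p m) : EuclideanSpace ℝ (Fin m) :=
  WithLp.toLp 2 fun j => v (Sum.inr (Sum.inr (Sum.inr j)))

/-- The second-order cone `K`, the product of the Lorentz cones `x_{i0} ≥ ‖x̄ᵢ‖`. -/
def cone (p : Fin r → ℕ) : Set (Space p) := {x | ∀ i, ‖tail x i‖ ≤ head x i}

/-- The extended cone `K × ℒₙ × ℒₘ`. -/
def extCone (p : Fin r → ℕ) (m : ℕ) : Set (ExtSpace p m) :=
  {v | partX v ∈ cone p ∧ ‖partX' v‖ ≤ partT v ∧ ‖partX'' v‖ ≤ partTau v}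

/-- The extended constraint matrix with the block rows
`(A, 0, 0, 0, I)`, `(-I, 0, I, 0, 0)`, `(0, 1, 0, 0, 0)`. -/
def extMatrix (A : Matrix (Fin m) (Idx p) ℝ) : Matrix (DualIdx p m) (ExtIdx p m) ℝ :=
  Matrix.fromRows
    (Matrix.fromCols A
      (Matrix.fromCols (Matrix.fromCols 0 0) (Matrix.fromCols 0 1)))
    (Matrix.fromRows
      (Matrix.fromCols (-1)
        (Matrix.fromCols (Matrix.fromCols 0 1) (Matrix.fromCols 0 0)))
      (Matrix.fromCols 0
        (Matrix.fromCols (Matrix.fromCols 1 0) (Matrix.fromCols 0 0))))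

/-- The right-hand side `(0, 0, 1)` of the primal equations. -/
def rhs (p : Fin r → ℕ) (m : ℕ) : DualIdx p m → ℝ :=
  Sum.elim 0 (Sum.elim 0 1)

/-- The cost vector `(0, 0, 0, 1, 0)`. -/
def cost (p : Fin r → ℕ) (m : ℕ) : ExtIdx p m → ℝ :=
  Sum.elim 0 (Sum.elim (Sum.elim 0 0) (Sum.elim 1 0))

/-- The logarithmic barrier
`f = -(∑ᵢ ln (x_{i0}² - ‖x̄ᵢ‖²) + ln (t² - ‖x'‖²) + ln (τ² - ‖x''‖²))`. -/
def barrier (v : ExtSpace p m) : ℝ :=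
  -((∑ i, Real.log (head (partX v) i ^ 2 - ‖tail (partX v) i‖ ^ 2))
    + Real.log (partT v ^ 2 - ‖partX' v‖ ^ 2)
    + Real.log (partTau v ^ 2 - ‖partX'' v‖ ^ 2))

/-- The gradient `g` of the barrier. -/
def grad (v : ExtSpace p m) : ExtSpace p m := gradient barrier v

/-- The Hessian `H` of the barrier, as a linear operator. -/
def hess (v : ExtSpace p m) : ExtSpace p m →L[ℝ] ExtSpace p m := fderiv ℝ grad v

/-- The local norm `‖u‖_v = (uᵀ H(v) u)^(1/2)`. -/
def localNorm (v u : ExtSpace p m) : ℝ := √⟪u, hess v u⟫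

/-- Primal-dual triples `z = (x, y, s)` of extended vectors. -/
@[ext]
structure Triple (p : Fin r → ℕ) (m : ℕ) where
  x : ExtSpace p m
  y : DualSpace p m
  s : ExtSpace p m

instance : Add (Triple p m) := ⟨fun z d => ⟨z.x + d.x, z.y + d.y, z.s + d.s⟩⟩

/-- The number `r + 2` of Lorentz cones in the extended cone, as a real number. -/
def numCones (r : ℕ) : ℝ := (r : ℝ) + 2

/-- The duality measure `μ(z) = xᵀ s / (2 (r + 2))`. -/
def mu (z : Triple p m) : ℝ := ⟪z.x, z.s⟫ / (2 * numCones r)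

/-- The central neighborhood with radius `β`. -/
def neighborhood (A : Matrix (Fin m) (Idx p) ℝ) (β : ℝ) : Set (Triple p m) :=
  {z | z.x ∈ interior (extCone p m) ∧ z.s ∈ interior (extCone p m) ∧
    extMatrix A *ᵥ z.x.ofLp = rhs p m ∧
    (extMatrix A)ᵀ *ᵥ z.y.ofLp + z.s.ofLp = cost p m ∧
    localNorm (-(mu z • grad z.x)) (z.s + mu z • grad z.x) ≤ β}

/-- `w` is a scaling point of `(x, s)`: it lies in the interior of the extended cone and
`H(w) x = s`. -/
def IsScalingPoint (w x s : ExtSpace p m) : Prop :=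
  w ∈ interior (extCone p m) ∧ hess w x = s

/-- The Frobenius norm of the block `Aᵢ` formed by the columns of `A` that belong to
block `i`. -/
def blockFrobenius (A : Matrix (Fin m) (Idx p) ℝ) (i : Fin r) : ℝ :=
  √(∑ k, ∑ j, A k ⟨i, j⟩ ^ 2)

end ConicIPM

end

/-! Each Lorentz cone is the cone of squares of a spin factor with unit `e`, and the Hessian of
`-log det` at `w` is twice the inverse of the quadratic representation `quad e w`. If `a` is a
square root of `w`, then `G = quad e a` is a self-adjoint automorphism of the cone with `G² = quad e
w`, so `H(w) x = s` says that `G⁻¹ x` and `G s / 2` are the same point `v`. The squared local norm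
that defines the neighborhood is a sum over blocks of `prox`, which depends only on `⟪x, s⟫` and
`det x * det s` (`inner_logHess_eq_prox`) and is therefore unchanged by the scaling `(G⁻¹, G)`.

In the scaled variables the Newton equation reads `dx + ds = c μ v⁻¹ - v + r` with `dx`, `ds`
orthogonal, and the new complementarity error is `(v + dx) ∘ (v + ds) - c μ e = dx ∘ ds + v ∘ r`
(`jord_newton`). The first term is quadratic in a step whose squared norm is `O(β μ)`, the second is
controlled by the residual, and both fit into the radius `β` (`scaled_step`, transported back by
`perturbed_step`).

The residual tolerance is governed by the dual slack. The gap `xᵀ s` equals `τ + t`, with `τ` taken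
from `x` and `t` from `s`, so `t ≤ 2 (r + 2) μ`. The dual equations and `‖A‖_F = 1` then bound every
head of `s` by `M = 2 (r + 2) μ + 1` and `‖s‖` by `2 M`. The same bound controls the drift of `μ`,
since pairing the Newton equation with `s` leaves only `⟪ρ, s⟫` as error (`perturbed_step_measure`).
-/

noncomputable section

namespace Lorentz

/-! ### The Jordan algebra of one Lorentz cone, in coordinate-free form. -/

section Block

variable {V : Type*} [NormedAddCommGroup V] [InnerProductSpace ℝ V]

/-- The reflection `(u₀, ū) ↦ (u₀, -ū)`, where `u₀` is the coordinate along `e`. -/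
def refl (e : V) : V →L[ℝ] V := (2 : ℝ) • (innerSL ℝ e).smulRight e - ContinuousLinearMap.id ℝ V

/-- The Lorentz determinant `u₀² - ‖ū‖²`. -/
def det (e u : V) : ℝ := 2 * ⟪e, u⟫ ^ 2 - ⟪u, u⟫

/-- The quadratic representation of `a`. -/
def quad (e a : V) : V →L[ℝ] V := (2 : ℝ) • (innerSL ℝ a).smulRight a - det e a • refl e

/-- The interior of the Lorentz cone with axis `e`. -/
def IsInt (e u : V) : Prop := ‖u - ⟪e, u⟫ • e‖ < ⟪e, u⟫

/-- The Jordan product of the spin factor with unit `e`. -/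
def jord (e x y : V) : V := ⟪e, x⟫ • y + ⟪e, y⟫ • x - ⟪x, refl e y⟫ • e

/-- The contribution of a block to the squared distance of `(x, s)` from the central path. -/
def prox (e : V) (μ : ℝ) (x s : V) : ℝ :=
  (⟪x, s⟫ / μ) ^ 2 - 2 * ⟪x, s⟫ / μ + 2 - det e x * det e s / (2 * μ ^ 2)

theorem refl_apply (e u : V) : refl e u = (2 * ⟪e, u⟫) • e - u := by
  simp [refl, smul_smul]

theorem quad_apply (e a u : V) : quad e a u = (2 * ⟪a, u⟫) • a - det e a • refl e u := by
  simp [quad, smul_smul]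

variable {e : V}

theorem inner_self_of_norm (he : ‖e‖ = 1) : ⟪e, e⟫ = 1 := by
  rw [real_inner_self_eq_norm_sq, he]; norm_num

theorem refl_refl (he : ‖e‖ = 1) (u : V) : refl e (refl e u) = u := by
  have h := inner_self_of_norm he
  simp only [refl_apply, inner_sub_right, inner_smul_right, h]
  module

theorem inner_refl_left (u v : V) : ⟪refl e u, v⟫ = ⟪u, refl e v⟫ := by
  simp only [refl_apply, inner_sub_right, inner_smul_right, inner_sub_left, real_inner_smul_left,
    real_inner_comm e u]
  ring

theorem inner_refl_self (u : V) : ⟪u, refl e u⟫ = det e u := by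
  simp only [refl_apply, inner_sub_right, inner_smul_right, det, real_inner_comm e u]
  ring

theorem inner_quad_left (a u v : V) : ⟪quad e a u, v⟫ = ⟪u, quad e a v⟫ := by
  simp only [quad_apply, inner_sub_right, inner_smul_right, inner_sub_left, real_inner_smul_left,
    inner_refl_left, real_inner_comm a u]
  ring

theorem inner_refl_refl (he : ‖e‖ = 1) (u v : V) : ⟪refl e u, refl e v⟫ = ⟪u, v⟫ := by
  rw [inner_refl_left, refl_refl he]

/-- Up to the factor `det e a`, `quad e a` is a Lorentz transformation. This yields its inverse, the
multiplicativity of `det`, and `quad_quad`. -/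
theorem quad_refl_quad (he : ‖e‖ = 1) (a u : V) :
    quad e a (refl e (quad e a u)) = det e a ^ 2 • refl e u := by
  rw [quad_apply e a (refl e _), refl_refl he, ← inner_refl_left, ← inner_quad_left,
    quad_apply e a (refl e a), quad_apply e a u, inner_refl_self, refl_refl he,
    inner_sub_left, real_inner_smul_left, real_inner_smul_left]
  module

theorem det_refl (he : ‖e‖ = 1) (u : V) : det e (refl e u) = det e u := by
  rw [← inner_refl_self, refl_refl he, real_inner_comm, inner_refl_self]

theorem det_quad (he : ‖e‖ = 1) (a u : V) : det e (quad e a u) = det e a ^ 2 * det e u := by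
  rw [← inner_refl_self, inner_quad_left, quad_refl_quad he, inner_smul_right, inner_refl_self]

theorem det_smul (c : ℝ) (u : V) : det e (c • u) = c ^ 2 * det e u := by
  simp only [det, inner_smul_right, real_inner_smul_left]; ring

theorem quad_unit (he : ‖e‖ = 1) (u : V) : quad e e u = u := by
  have h := inner_self_of_norm he
  rw [quad_apply, refl_apply, det, h]
  module

/-- This is the fundamental formula `P(P(a) e) = P(a) P(e) P(a)` with `P(e) = id`. -/
theorem quad_quad (he : ‖e‖ = 1) (a u : V) :
    quad e (quad e a e) u = quad e a (quad e a u) := by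
  conv_rhs => rw [← quad_unit he (quad e a u), quad_apply e e, map_sub, map_smul, map_smul,
    quad_refl_quad he, ← inner_quad_left]
  rw [quad_apply e (quad e a e), det_quad he, smul_smul]
  congr 2
  ring

theorem norm_sub_axis_sq (he : ‖e‖ = 1) (u : V) :
    ‖u - ⟪e, u⟫ • e‖ ^ 2 = ⟪u, u⟫ - ⟪e, u⟫ ^ 2 := by
  have h := inner_self_of_norm he
  rw [← real_inner_self_eq_norm_sq]
  simp only [inner_sub_right, inner_smul_right, inner_sub_left, real_inner_smul_left, h,
    real_inner_comm e u]
  ring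

theorem inner_tail_sq_le (he : ‖e‖ = 1) (u v : V) :
    (⟪u, v⟫ - ⟪e, u⟫ * ⟪e, v⟫) ^ 2
      ≤ (⟪u, u⟫ - ⟪e, u⟫ ^ 2) * (⟪v, v⟫ - ⟪e, v⟫ ^ 2) := by
  have h := inner_self_of_norm he
  have hc := real_inner_mul_inner_self_le (u - ⟪e, u⟫ • e) (v - ⟪e, v⟫ • e)
  rw [real_inner_self_eq_norm_sq, real_inner_self_eq_norm_sq, norm_sub_axis_sq he,
    norm_sub_axis_sq he] at hc
  have : ⟪u - ⟪e, u⟫ • e, v - ⟪e, v⟫ • e⟫ = ⟪u, v⟫ - ⟪e, u⟫ * ⟪e, v⟫ := by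
    simp only [inner_sub_right, inner_smul_right, inner_sub_left, real_inner_smul_left, h,
      real_inner_comm e u]
    ring
  rw [this] at hc
  linarith [sq (⟪u, v⟫ - ⟪e, u⟫ * ⟪e, v⟫)]

theorem isInt_iff (he : ‖e‖ = 1) (u : V) : IsInt e u ↔ 0 < ⟪e, u⟫ ∧ 0 < det e u := by
  have h1 := norm_sub_axis_sq he u
  have h0 := norm_nonneg (u - ⟪e, u⟫ • e)
  unfold IsInt det
  constructor
  · intro h
    exact ⟨h0.trans_lt h, by nlinarith⟩
  · rintro ⟨h2, h3⟩
    exact lt_of_pow_lt_pow_left₀ 2 h2.le (by linarith)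

theorem IsInt.head_pos {u : V} (hu : IsInt e u) : 0 < ⟪e, u⟫ := (norm_nonneg _).trans_lt hu

theorem IsInt.det_pos {u : V} (hu : IsInt e u) (he : ‖e‖ = 1) : 0 < det e u :=
  ((isInt_iff he u).1 hu).2

theorem IsInt.inner_pos (he : ‖e‖ = 1) {u v : V} (hu : IsInt e u) (hv : IsInt e v) :
    0 < ⟪u, v⟫ := by
  have h := inner_tail_sq_le he u v
  rw [← norm_sub_axis_sq he, ← norm_sub_axis_sq he, ← mul_pow] at h
  have h2 := abs_le_of_sq_le_sq' h (by positivity)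
  have h3 : ‖u - ⟪e, u⟫ • e‖ * ‖v - ⟪e, v⟫ • e‖ < ⟪e, u⟫ * ⟪e, v⟫ :=
    mul_lt_mul'' hu hv (norm_nonneg _) (norm_nonneg _)
  linarith [h2.1]

theorem inner_unit_refl (he : ‖e‖ = 1) (u : V) : ⟪e, refl e u⟫ = ⟪e, u⟫ := by
  rw [refl_apply, inner_sub_right, inner_smul_right, inner_self_of_norm he]; ring

theorem IsInt.refl (he : ‖e‖ = 1) {u : V} (hu : IsInt e u) : IsInt e (refl e u) := by
  rw [isInt_iff he, inner_unit_refl he, det_refl he]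
  exact (isInt_iff he u).1 hu

/-- A square root satisfies `a² - 2 a₀ a + (det a) e = 0`. With `a² = w` and `det a = √(det w)` this
forces `a` to be `w + √(det w) e` divided by `k = 2 a₀`. -/
theorem exists_sqrt (he : ‖e‖ = 1) {w : V} (hw : IsInt e w) :
    ∃ a : V, 0 < det e a ∧ quad e a e = w := by
  have h := inner_self_of_norm he
  obtain ⟨h0, hd⟩ := (isInt_iff he w).1 hw
  set ω := √(det e w) with hω
  have hω0 : 0 < ω := Real.sqrt_pos.2 hd
  have hω2 : ω ^ 2 = det e w := Real.sq_sqrt hd.le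
  set k := √(2 * (⟪e, w⟫ + ω)) with hk
  have hk0 : 0 < k := Real.sqrt_pos.2 (by positivity)
  have hk2 : k ^ 2 = 2 * (⟪e, w⟫ + ω) := Real.sq_sqrt (by positivity)
  have hdet : det e (k⁻¹ • (w + ω • e)) = ω := by
    rw [det_smul]
    have : det e (w + ω • e) = k ^ 2 * ω := by
      rw [hk2]
      unfold det at hω2 ⊢
      simp only [inner_add_right, inner_add_left, inner_smul_right, real_inner_smul_left, h,
        real_inner_comm e w]
      linear_combination -hω2
    rw [this]
    field_simp
  refine ⟨k⁻¹ • (w + ω • e), by rw [hdet]; exact hω0, ?_⟩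
  have hin : ⟪k⁻¹ • (w + ω • e), e⟫ = k / 2 := by
    rw [real_inner_smul_left, inner_add_left, real_inner_smul_left, h, real_inner_comm e w]
    field_simp
    linarith
  rw [quad_apply, hdet, hin, refl_apply, h, smul_smul]
  have : 2 * (k / 2) * k⁻¹ = 1 := by field_simp
  rw [this]
  module

/-- The symmetric automorphism of the Lorentz cone attached to an interior point `w`. -/
theorem exists_scaling (he : ‖e‖ = 1) {w : V} (hw : IsInt e w) :
    ∃ (G Gi : V →L[ℝ] V) (D : ℝ), 0 < D ∧ (∀ u, G (Gi u) = u) ∧ (∀ u, Gi (G u) = u) ∧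
      (∀ u v, ⟪G u, v⟫ = ⟪u, G v⟫) ∧ (∀ u, det e (G u) = D * det e u) ∧
      (∀ u, G (Lorentz.refl e (G u)) = D • Lorentz.refl e u) ∧
      (∀ u, quad e w u = G (G u)) ∧
      (∀ u, IsInt e u → IsInt e (G u)) ∧ (∀ u, IsInt e u → IsInt e (Gi u)) := by
  obtain ⟨a, ha, haw⟩ := exists_sqrt he hw
  have hD : (0 : ℝ) < det e a ^ 2 := by positivity
  refine ⟨quad e a, (det e a ^ 2)⁻¹ • (Lorentz.refl e ∘L quad e a ∘L Lorentz.refl e),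
    det e a ^ 2, hD, ?_, ?_, inner_quad_left a, det_quad he a, quad_refl_quad he a, ?_, ?_, ?_⟩
  · intro u
    simp only [_root_.smul_apply, ContinuousLinearMap.comp_apply, map_smul,
      quad_refl_quad he, refl_refl he, smul_smul]
    rw [inv_mul_cancel₀ hD.ne', one_smul]
  · intro u
    simp only [_root_.smul_apply, ContinuousLinearMap.comp_apply, map_smul,
      quad_refl_quad he, refl_refl he, smul_smul]
    rw [inv_mul_cancel₀ hD.ne', one_smul]
  · intro u
    rw [← haw, quad_quad he]
  -- The determinant is multiplied by `D > 0`, and the head of `quad e a u` is `⟪quad e a e, u⟫ =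
  -- ⟪w, u⟫`, which is positive by self-duality of the cone.
  · intro u hu
    rw [isInt_iff he, det_quad he, ← inner_quad_left, haw]
    exact ⟨hw.inner_pos he hu, mul_pos hD (hu.det_pos he)⟩
  · intro u hu
    have hr := hu.refl he
    rw [isInt_iff he]
    simp only [_root_.smul_apply, ContinuousLinearMap.comp_apply]
    rw [det_smul, det_refl he, det_quad he, inner_smul_right, inner_unit_refl he,
      ← inner_quad_left, haw]
    have := hw.inner_pos he hr
    have := hr.det_pos he
    exact ⟨by positivity, by positivity⟩

theorem norm_jord_sub_sq (he : ‖e‖ = 1) (x y : V) (c : ℝ) :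
    ‖jord e x y - c • e‖ ^ 2 = (⟪x, y⟫ - c) ^ 2 + ⟪e, x⟫ ^ 2 * ⟪y, y⟫ + ⟪e, y⟫ ^ 2 * ⟪x, x⟫
      - 4 * ⟪e, x⟫ ^ 2 * ⟪e, y⟫ ^ 2 + 2 * ⟪e, x⟫ * ⟪e, y⟫ * ⟪x, y⟫ := by
  have h := inner_self_of_norm he
  rw [← real_inner_self_eq_norm_sq]
  simp only [jord, refl_apply, inner_sub_right, inner_smul_right, inner_sub_left,
    real_inner_smul_left, inner_add_left, inner_add_right, h, real_inner_comm e x,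
    real_inner_comm e y, real_inner_comm x y]
  ring

theorem norm_jord_sq_le (he : ‖e‖ = 1) (x y : V) :
    ‖jord e x y‖ ^ 2 ≤ 2 * ‖x‖ ^ 2 * ‖y‖ ^ 2 := by
  have h := norm_jord_sub_sq he x y 0
  rw [zero_smul, sub_zero] at h
  have hc := inner_tail_sq_le he x y
  have hX : 0 ≤ ⟪x, x⟫ - ⟪e, x⟫ ^ 2 := by rw [← norm_sub_axis_sq he]; positivity
  have hY : 0 ≤ ⟪y, y⟫ - ⟪e, y⟫ ^ 2 := by rw [← norm_sub_axis_sq he]; positivity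
  rw [h, ← real_inner_self_eq_norm_sq, ← real_inner_self_eq_norm_sq]
  generalize ⟪e, x⟫ = a at *
  generalize ⟪e, y⟫ = b at *
  obtain ⟨c, hcp⟩ : ∃ c, c = ⟪x, y⟫ - a * b := ⟨_, rfl⟩
  obtain ⟨X, hXp⟩ : ∃ X, X = ⟪x, x⟫ - a ^ 2 := ⟨_, rfl⟩
  obtain ⟨Y, hYp⟩ : ∃ Y, Y = ⟪y, y⟫ - b ^ 2 := ⟨_, rfl⟩
  rw [← hcp, ← hXp, ← hYp] at hc
  rw [← hXp] at hX
  rw [← hYp] at hY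
  have e1 : ⟪x, y⟫ = c + a * b := by linarith
  have e2 : ⟪x, x⟫ = X + a ^ 2 := by linarith
  have e3 : ⟪y, y⟫ = Y + b ^ 2 := by linarith
  rw [e1, e2, e3]
  -- Here `c`, `X`, `Y` are the inner product and squared norms of the tails. Since `c² ≤ X Y`, this
  -- is the AM-GM inequality for `a² Y` and `b² X`.
  have h4 : 2 * (a * b) * c ≤ a ^ 2 * Y + b ^ 2 * X := by
    refine (abs_le_of_sq_le_sq' ?_ (by positivity)).2
    nlinarith [sq_nonneg (a ^ 2 * Y - b ^ 2 * X), mul_nonneg (sq_nonneg (a * b)) (sub_nonneg.2 hc)]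
  nlinarith [sq_nonneg (a * b - c), mul_nonneg hX hY]

/-- The difference of the two sides is `2 / μ²` times the Cauchy–Schwarz defect of the tails of `x`
and `y`. -/
theorem prox_two_smul_le (he : ‖e‖ = 1) {μ : ℝ} (hμ : 0 < μ) (x y : V) :
    prox e μ x ((2 : ℝ) • y) ≤ 2 / μ ^ 2 * ‖jord e x y - μ • e‖ ^ 2 := by
  have hc := inner_tail_sq_le he x y
  rw [norm_jord_sub_sq he, prox, det_smul, inner_smul_right]
  unfold det
  rw [← sub_nonneg]
  have : 0 ≤ 2 / μ ^ 2 * ((⟪x, x⟫ - ⟪e, x⟫ ^ 2) * (⟪y, y⟫ - ⟪e, y⟫ ^ 2)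
      - (⟪x, y⟫ - ⟪e, x⟫ * ⟪e, y⟫) ^ 2) := mul_nonneg (by positivity) (by linarith)
  convert this using 1
  field_simp
  ring

theorem jord_add_add (x y u v : V) :
    jord e (x + u) (y + v) = jord e x y + jord e x v + jord e u y + jord e u v := by
  simp only [jord, inner_add_left, inner_add_right, map_add]
  module

theorem jord_comm (x y : V) : jord e x y = jord e y x := by
  simp only [jord]
  rw [← inner_refl_left x y, real_inner_comm y (refl e x)]
  module

theorem jord_refl_self (he : ‖e‖ = 1) (v : V) : jord e v (refl e v) = det e v • e := by
  simp only [jord, refl_refl he, inner_unit_refl he]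
  rw [refl_apply]
  simp only [det]
  module

theorem jord_smul_right (c : ℝ) (x y : V) : jord e x (c • y) = c • jord e x y := by
  simp only [jord, inner_smul_right, map_smul]
  module

theorem jord_add_right (x y z : V) : jord e x (y + z) = jord e x y + jord e x z := by
  simp only [jord, inner_add_right, map_add]
  module

theorem jord_sub_right (x y z : V) : jord e x (y - z) = jord e x y - jord e x z := by
  simp only [jord, inner_sub_right, map_sub]
  module

/-- The complementarity error after a Newton step with residual `r`. -/
theorem jord_newton (he : ‖e‖ = 1) {v dx ds r : V} {c : ℝ} (hv : det e v ≠ 0)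
    (h : dx + ds = (c / det e v) • refl e v - v + r) :
    jord e (v + dx) (v + ds) - c • e = jord e dx ds + jord e v r := by
  have h1 : jord e v ds + jord e dx v = c • e - jord e v v + jord e v r := by
    rw [jord_comm dx v, ← jord_add_right, add_comm ds dx, h, jord_add_right, jord_sub_right,
      jord_smul_right, jord_refl_self he, smul_smul, div_mul_cancel₀ _ hv]
  rw [jord_add_add, add_assoc (jord e v v), h1]
  abel

/-- The two spectral values of an interior point. -/
theorem IsInt.exists_spectrum (he : ‖e‖ = 1) {v : V} (hv : IsInt e v) :
    ∃ a b : ℝ, 0 < b ∧ b ≤ a ∧ ⟪v, v⟫ = (a ^ 2 + b ^ 2) / 2 ∧ det e v = a * b ∧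
      ‖v - ⟪e, v⟫ • e‖ + b = ⟪e, v⟫ := by
  have h := norm_sub_axis_sq he v
  have h0 := norm_nonneg (v - ⟪e, v⟫ • e)
  unfold IsInt at hv
  refine ⟨⟪e, v⟫ + ‖v - ⟪e, v⟫ • e‖, ⟪e, v⟫ - ‖v - ⟪e, v⟫ • e‖, by linarith, by linarith, ?_, ?_,
    by ring⟩
  · linear_combination -h
  · unfold det
    linear_combination h

theorem prox_two_smul_self {μ a b : ℝ} {v : V}
    (h1 : ⟪v, v⟫ = (a ^ 2 + b ^ 2) / 2) (h2 : det e v = a * b) :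
    prox e μ v ((2 : ℝ) • v) = (a ^ 2 / μ - 1) ^ 2 + (b ^ 2 / μ - 1) ^ 2 := by
  rw [prox, det_smul, inner_smul_right, h1, h2]
  ring

theorem IsInt.prox_two_smul_self_nonneg (he : ‖e‖ = 1) {v : V} (hv : IsInt e v) (μ : ℝ) :
    0 ≤ prox e μ v ((2 : ℝ) • v) := by
  obtain ⟨a, b, -, -, h1, h2, -⟩ := hv.exists_spectrum he
  rw [prox_two_smul_self h1 h2]
  positivity

/-- By `prox_two_smul_self` the squared spectral values divided by `μ` each lie within `β` of `1`.
-/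
theorem IsInt.spectrum_bounds (he : ‖e‖ = 1) {v : V} (hv : IsInt e v) {μ β : ℝ} (hμ : 0 < μ)
    (hβ : 0 ≤ β) (h : prox e μ v ((2 : ℝ) • v) ≤ β ^ 2) :
    (1 - β) * μ ≤ (⟪e, v⟫ - ‖v - ⟪e, v⟫ • e‖) ^ 2 ∧ ⟪v, v⟫ ≤ (1 + β) * μ := by
  obtain ⟨a, b, hb, hab, h1, h2, h3⟩ := hv.exists_spectrum he
  rw [prox_two_smul_self h1 h2] at h
  have ha := abs_le_of_sq_le_sq' (show (a ^ 2 / μ - 1) ^ 2 ≤ β ^ 2 by nlinarith) hβ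
  have hb := abs_le_of_sq_le_sq' (show (b ^ 2 / μ - 1) ^ 2 ≤ β ^ 2 by nlinarith) hβ
  have ha2 : a ^ 2 ≤ (1 + β) * μ := (div_le_iff₀ hμ).1 (by linarith)
  have hb2 : b ^ 2 ≤ (1 + β) * μ := (div_le_iff₀ hμ).1 (by linarith)
  have hb3 : (1 - β) * μ ≤ b ^ 2 := (le_div_iff₀ hμ).1 (by linarith)
  have : ⟪e, v⟫ - ‖v - ⟪e, v⟫ • e‖ = b := by linarith
  rw [this, h1]
  exact ⟨hb3, by linarith⟩

/-- The norm of the unperturbed Newton right-hand side of one block. -/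
theorem IsInt.norm_newton_rhs_sq_le (he : ‖e‖ = 1) {v : V} (hv : IsInt e v) {μ β : ℝ} (hμ : 0 < μ)
    (hβ : 0 ≤ β) (hβ1 : β < 1) (h : prox e μ v ((2 : ℝ) • v) ≤ β ^ 2) (c : ℝ) :
    ‖(c * μ / det e v) • Lorentz.refl e v - v‖ ^ 2 ≤ μ / (2 * (1 - β)) *
      (prox e μ v ((2 : ℝ) • v) - 4 * (1 - c) * (1 - ⟪v, v⟫ / μ) + 2 * (1 - c) ^ 2) := by
  have hlow := (hv.spectrum_bounds he hμ hβ h).1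
  obtain ⟨a, b, hb, hab, h1, h2, h3⟩ := hv.exists_spectrum he
  have ha : 0 < a := hb.trans_le hab
  have hb3 : (1 - β) * μ ≤ b ^ 2 := by
    rwa [show ⟪e, v⟫ - ‖v - ⟪e, v⟫ • e‖ = b by linarith] at hlow
  have ha3 : (1 - β) * μ ≤ a ^ 2 := hb3.trans (by gcongr)
  -- The vector has spectral values `c μ / a - a` and `c μ / b - b`. Replacing the denominators
  -- `a²`, `b²` by `(1 - β) μ` gives the bound.
  have hL : ‖(c * μ / det e v) • Lorentz.refl e v - v‖ ^ 2
      = (1 / 2) * ((c * μ - a ^ 2) ^ 2 / a ^ 2 + (c * μ - b ^ 2) ^ 2 / b ^ 2) := by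
    rw [← real_inner_self_eq_norm_sq]
    simp only [inner_sub_left, inner_sub_right, real_inner_smul_left, inner_smul_right,
      inner_refl_refl he, inner_refl_left, inner_refl_self]
    rw [h1, h2]
    field_simp
    ring
  have hR : μ / (2 * (1 - β)) *
      (prox e μ v ((2 : ℝ) • v) - 4 * (1 - c) * (1 - ⟪v, v⟫ / μ) + 2 * (1 - c) ^ 2)
      = (1 / 2) * ((c * μ - a ^ 2) ^ 2 / ((1 - β) * μ) + (c * μ - b ^ 2) ^ 2 / ((1 - β) * μ)) := by
    rw [prox_two_smul_self h1 h2, h1]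
    have : 1 - β ≠ 0 := by linarith
    field_simp
    ring
  have h1β : 0 < (1 - β) * μ := mul_pos (by linarith) hμ
  rw [hL, hR]
  gcongr

/-- The right side is `⟪quad e v u, u⟫`, and the least eigenvalue of `quad e v` is the square of the
smaller spectral value of `v`. -/
theorem IsInt.sq_mul_norm_sq_le (he : ‖e‖ = 1) {v : V} (hv : IsInt e v) (u : V) :
    (⟪e, v⟫ - ‖v - ⟪e, v⟫ • e‖) ^ 2 * ‖u‖ ^ 2 ≤ 2 * ⟪v, u⟫ ^ 2 - det e v * det e u := by
  have hn := norm_sub_axis_sq he v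
  have hc := inner_tail_sq_le he v u
  rw [← hn] at hc
  have hh := hv.head_pos
  have hlt : ‖v - ⟪e, v⟫ • e‖ < ⟪e, v⟫ := hv
  have h0 := norm_nonneg (v - ⟪e, v⟫ • e)
  rw [← real_inner_self_eq_norm_sq]
  unfold det
  generalize ‖v - ⟪e, v⟫ • e‖ = n at *
  have hvv : ⟪v, v⟫ = n ^ 2 + ⟪e, v⟫ ^ 2 := by linarith
  rw [hvv]
  generalize ⟪e, v⟫ = a at *
  generalize ⟪e, u⟫ = b at *
  obtain ⟨k, hk⟩ : ∃ k, k = ⟪v, u⟫ - a * b := ⟨_, rfl⟩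
  obtain ⟨U, hU⟩ : ∃ U, U = ⟪u, u⟫ - b ^ 2 := ⟨_, rfl⟩
  rw [← hk, ← hU] at hc
  rw [show ⟪v, u⟫ = k + a * b by linarith, show ⟪u, u⟫ = U + b ^ 2 by linarith]
  rcases h0.eq_or_lt with h | h
  · subst h
    have : k = 0 := by
      have : k ^ 2 ≤ 0 := by linarith
      nlinarith
    subst this
    nlinarith
  -- After multiplication by the tail norm `n`, the difference is exactly the sum of the two
  -- nonnegative terms `h5` and `h6`.
  · have key : 0 ≤ n * ((2 * (k + a * b) ^ 2 - (2 * a ^ 2 - (n ^ 2 + a ^ 2)) *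
        (2 * b ^ 2 - (U + b ^ 2))) - (a - n) ^ 2 * (U + b ^ 2)) := by
      have h5 : 0 ≤ 2 * (a - n) * (n ^ 2 * U - k ^ 2) :=
        mul_nonneg (by linarith) (by linarith)
      have h6 : 0 ≤ 2 * a * (n * b + k) ^ 2 := by positivity
      nlinarith
    have := nonneg_of_mul_nonneg_right key h
    linarith

/-- The form belongs to `quad e s`, whose spectrum is bounded by the square of the larger spectral
value of `s`, at most twice the head. -/
theorem IsInt.quad_form_le (he : ‖e‖ = 1) {s : V} (hs : IsInt e s) (u : V) :
    2 * ⟪s, u⟫ ^ 2 - det e s * det e u ≤ 4 * ⟪e, s⟫ ^ 2 * ‖u‖ ^ 2 := by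
  have hd := hs.det_pos he
  have h1 := real_inner_mul_inner_self_le s u
  have h2 : -det e u ≤ ⟪u, u⟫ := by unfold det; nlinarith [sq_nonneg ⟪e, u⟫]
  have h3 : 0 ≤ ⟪u, u⟫ := real_inner_self_nonneg
  have h4 : ⟪s, s⟫ ≤ 2 * ⟪e, s⟫ ^ 2 := by unfold det at hd; linarith
  have h5 : det e s + 2 * ⟪s, s⟫ ≤ 4 * ⟪e, s⟫ ^ 2 := by unfold det; linarith
  rw [← real_inner_self_eq_norm_sq]
  calc 2 * ⟪s, u⟫ ^ 2 - det e s * det e u ≤ 2 * (⟪s, s⟫ * ⟪u, u⟫) + det e s * ⟪u, u⟫ := by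
        nlinarith [mul_le_mul_of_nonneg_left h2 hd.le]
    _ = (det e s + 2 * ⟪s, s⟫) * ⟪u, u⟫ := by ring
    _ ≤ _ := by gcongr

theorem abs_head_le (he : ‖e‖ = 1) (u : V) : |⟪e, u⟫| ≤ ‖u‖ := by
  simpa [he] using abs_real_inner_le_norm e u

theorem norm_sub_axis_le (he : ‖e‖ = 1) (u : V) : ‖u - ⟪e, u⟫ • e‖ ≤ ‖u‖ := by
  refine (abs_le_of_sq_le_sq' ?_ (norm_nonneg u)).2
  rw [norm_sub_axis_sq he, real_inner_self_eq_norm_sq]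
  nlinarith [sq_nonneg ⟪e, u⟫]

/-- Head and tail norm each move by at most `‖u‖`, which accounts for the factor `2`. -/
theorem IsInt.add (he : ‖e‖ = 1) {v u : V} (h : 2 * ‖u‖ < ⟪e, v⟫ - ‖v - ⟪e, v⟫ • e‖) :
    IsInt e (v + u) := by
  have h1 := (abs_le.1 (abs_head_le he u)).1
  have h2 := norm_sub_axis_le he u
  have h3 := norm_add_le (v - ⟪e, v⟫ • e) (u - ⟪e, u⟫ • e)
  unfold IsInt
  rw [inner_add_right, show v + u - (⟪e, v⟫ + ⟪e, u⟫) • e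
    = (v - ⟪e, v⟫ • e) + (u - ⟪e, u⟫ • e) by module]
  linarith

end Block

/-! ### Newton step on a product of cones, in scaled coordinates. -/

section Family

variable {B : Type*} [Fintype B] {V : B → Type*} [∀ b, NormedAddCommGroup (V b)]
  [∀ b, InnerProductSpace ℝ (V b)]

theorem sum_norm_sq_add (x y : ∀ b, V b) :
    ∑ b, ‖x b + y b‖ ^ 2 = ∑ b, ‖x b‖ ^ 2 + 2 * ∑ b, ⟪x b, y b⟫ + ∑ b, ‖y b‖ ^ 2 := by
  rw [Finset.mul_sum, ← Finset.sum_add_distrib, ← Finset.sum_add_distrib]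
  exact Finset.sum_congr rfl fun b _ => norm_add_sq_real _ _

theorem sum_norm_sq_add_le {B : Type*} [Fintype B] {V : B → Type*}
    [∀ b, NormedAddCommGroup (V b)] (x y : ∀ b, V b) {k : ℝ} (hk : 0 < k) :
    ∑ b, ‖x b + y b‖ ^ 2 ≤ (1 + k) * ∑ b, ‖x b‖ ^ 2 + (1 + 1 / k) * ∑ b, ‖y b‖ ^ 2 := by
  rw [Finset.mul_sum, Finset.mul_sum, ← Finset.sum_add_distrib]
  refine Finset.sum_le_sum fun b _ => ?_
  calc ‖x b + y b‖ ^ 2 ≤ (‖x b‖ + ‖y b‖) ^ 2 := by gcongr; exact norm_add_le _ _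
    _ = (1 + k) * ‖x b‖ ^ 2 + (1 + 1 / k) * ‖y b‖ ^ 2 - (k * ‖x b‖ - ‖y b‖) ^ 2 / k := by
        field_simp; ring
    _ ≤ _ := sub_le_self _ (by positivity)

theorem sum_mul_le_sum_mul_sum {f g : B → ℝ} (hf : ∀ b, 0 ≤ f b) (hg : ∀ b, 0 ≤ g b) :
    ∑ b, f b * g b ≤ (∑ b, f b) * ∑ b, g b := by
  rw [Finset.sum_mul]
  refine Finset.sum_le_sum fun b _ => mul_le_mul_of_nonneg_left ?_ (hf b)
  exact Finset.single_le_sum (f := g) (fun c _ => hg c) (Finset.mem_univ b)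

/-- Orthogonality makes `∑ ‖dx + ds‖²` the sum of `X = ∑ ‖dx‖²` and `Y = ∑ ‖ds‖²`, and `2 X Y ≤ (X +
Y)² / 2`. -/
theorem sum_norm_jord_sq_le {e : ∀ b, V b} (he : ∀ b, ‖e b‖ = 1) {dx ds : ∀ b, V b}
    (h : ∑ b, ⟪dx b, ds b⟫ = 0) :
    ∑ b, ‖jord (e b) (dx b) (ds b)‖ ^ 2 ≤ (∑ b, ‖dx b + ds b‖ ^ 2) ^ 2 / 2 := by
  have h1 : ∑ b, ‖jord (e b) (dx b) (ds b)‖ ^ 2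
      ≤ 2 * ((∑ b, ‖dx b‖ ^ 2) * ∑ b, ‖ds b‖ ^ 2) := by
    calc ∑ b, ‖jord (e b) (dx b) (ds b)‖ ^ 2 ≤ ∑ b, 2 * (‖dx b‖ ^ 2 * ‖ds b‖ ^ 2) :=
          Finset.sum_le_sum fun b _ => by
            rw [← mul_assoc]; exact norm_jord_sq_le (he b) _ _
      _ = 2 * ∑ b, ‖dx b‖ ^ 2 * ‖ds b‖ ^ 2 := by rw [Finset.mul_sum]
      _ ≤ _ := by
          gcongr
          exact sum_mul_le_sum_mul_sum (fun b => by positivity) fun b => by positivity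
  rw [sum_norm_sq_add, h]
  nlinarith [sq_nonneg (∑ b, ‖dx b‖ ^ 2 - ∑ b, ‖ds b‖ ^ 2)]

/-- The mean of `⟪x, y⟫` minimizes the distance of `jord x y` to the multiples of the unit. -/
theorem sum_norm_jord_sub_le {e : ∀ b, V b} (he : ∀ b, ‖e b‖ = 1) (x y : ∀ b, V b) {μ : ℝ}
    (h : ∑ b, ⟪x b, y b⟫ = Fintype.card B * μ) (c : ℝ) :
    ∑ b, ‖jord (e b) (x b) (y b) - μ • e b‖ ^ 2 ≤ ∑ b, ‖jord (e b) (x b) (y b) - c • e b‖ ^ 2 := by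
  have key : ∑ b, ‖jord (e b) (x b) (y b) - c • e b‖ ^ 2
      = ∑ b, ‖jord (e b) (x b) (y b) - μ • e b‖ ^ 2 + Fintype.card B * (μ - c) ^ 2 := by
    have : ∀ b, ‖jord (e b) (x b) (y b) - c • e b‖ ^ 2
        = ‖jord (e b) (x b) (y b) - μ • e b‖ ^ 2 + 2 * (μ - c) * ⟪x b, y b⟫ + (c ^ 2 - μ ^ 2) := by
      intro b
      rw [norm_jord_sub_sq (he b), norm_jord_sub_sq (he b)]
      ring
    simp only [this]
    rw [Finset.sum_add_distrib, Finset.sum_add_distrib, ← Finset.mul_sum, h]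
    simp
    ring
  rw [key]
  exact le_add_of_nonneg_right (by positivity)

/-- A perturbed Newton step in the coordinates where both iterates coincide. -/
theorem scaled_step {e : ∀ b, V b} (he : ∀ b, ‖e b‖ = 1) {v dx ds r : ∀ b, V b}
    {μ μ' β c R : ℝ} (hμ : 0 < μ) (hβ0 : 0 < β) (hβ1 : β ≤ 1 / 15)
    (hv : ∀ b, IsInt (e b) (v b))
    (hmean : ∑ b, ⟪v b, v b⟫ = Fintype.card B * μ)
    (hprox : ∑ b, prox (e b) μ (v b) ((2 : ℝ) • v b) ≤ β ^ 2)
    (horth : ∑ b, ⟪dx b, ds b⟫ = 0)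
    (hnewton : ∀ b, dx b + ds b = (c * μ / det (e b) (v b)) • refl (e b) (v b) - v b + r b)
    (hr : ∑ b, ‖r b‖ ^ 2 ≤ R * μ)
    (hc : β ^ 2 + 2 * Fintype.card B * (1 - c) ^ 2 ≤ 5 / 16 * (1 - β) * β)
    (hR : R ≤ β ^ 2 / 28)
    (hmean' : ∑ b, ⟪v b + dx b, v b + ds b⟫ = Fintype.card B * μ')
    (hμ' : 9 / 10 * μ ≤ μ') :
    (∀ b, IsInt (e b) (v b + dx b)) ∧ (∀ b, IsInt (e b) (v b + ds b)) ∧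
      ∑ b, prox (e b) μ' (v b + dx b) ((2 : ℝ) • (v b + ds b)) ≤ β ^ 2 := by
  have hpb : ∀ b, prox (e b) μ (v b) ((2 : ℝ) • v b) ≤ β ^ 2 := fun b =>
    (Finset.single_le_sum (f := fun b => prox (e b) μ (v b) ((2 : ℝ) • v b))
      (fun b _ => (hv b).prox_two_smul_self_nonneg (he b) μ) (Finset.mem_univ b)).trans hprox
  have h1β : 0 < 1 - β := by linarith
  have hd0 : ∑ b, ‖(c * μ / det (e b) (v b)) • refl (e b) (v b) - v b‖ ^ 2 ≤ 5 / 32 * β * μ := by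
    calc _ ≤ ∑ b, μ / (2 * (1 - β)) * (prox (e b) μ (v b) ((2 : ℝ) • v b)
          - 4 * (1 - c) * (1 - ⟪v b, v b⟫ / μ) + 2 * (1 - c) ^ 2) :=
          Finset.sum_le_sum fun b _ =>
            (hv b).norm_newton_rhs_sq_le (he b) hμ hβ0.le (by linarith) (hpb b) c
      -- The terms linear in `1 - c` cancel in the sum because `μ` is the mean of the `⟪v b, v b⟫`.
      _ = μ / (2 * (1 - β)) * (∑ b, prox (e b) μ (v b) ((2 : ℝ) • v b)
          + 2 * Fintype.card B * (1 - c) ^ 2) := by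
          rw [← Finset.mul_sum, Finset.sum_add_distrib, Finset.sum_sub_distrib, ← Finset.mul_sum,
            Finset.sum_sub_distrib, ← Finset.sum_div, hmean]
          simp only [Finset.sum_const, Finset.card_univ, nsmul_eq_mul]
          field_simp
          ring
      _ ≤ μ / (2 * (1 - β)) * (5 / 16 * (1 - β) * β) := by gcongr; linarith
      _ = _ := by field_simp; ring
  have hd : ∑ b, ‖dx b + ds b‖ ^ 2 ≤ (5 / 4 * (5 / 32 * β) + 5 * R) * μ := by
    simp only [hnewton]
    refine (sum_norm_sq_add_le _ _ (show (0 : ℝ) < 1 / 4 by norm_num)).trans ?_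
    nlinarith
  have hR' : R ≤ β / 420 := by nlinarith
  -- Numerically `25/128 + 5/420 < 5/24`.
  have hd' : ∑ b, ‖dx b + ds b‖ ^ 2 ≤ 5 / 24 * β * μ := by
    refine hd.trans ?_
    gcongr
    linarith
  have hsplit := sum_norm_sq_add dx ds
  rw [horth, mul_zero, add_zero] at hsplit
  have hint : ∀ (d : ∀ b, V b), ∑ b, ‖d b‖ ^ 2 ≤ ∑ b, ‖dx b + ds b‖ ^ 2 →
      ∀ b, IsInt (e b) (v b + d b) := by
    intro d hdd b
    have h1 : ‖d b‖ ^ 2 ≤ ∑ b, ‖d b‖ ^ 2 := Finset.single_le_sum (f := fun b => ‖d b‖ ^ 2)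
      (fun c _ => by positivity) (Finset.mem_univ b)
    have h2 := ((hv b).spectrum_bounds (he b) hμ hβ0.le (hpb b)).1
    have h3 : 0 ≤ ⟪e b, v b⟫ - ‖v b - ⟪e b, v b⟫ • e b‖ := sub_nonneg.2 (hv b).le
    -- After squaring, `4 · (5/24) β μ < (1 - β) μ` suffices.
    refine IsInt.add (he b) (lt_of_pow_lt_pow_left₀ 2 h3 ?_)
    nlinarith
  refine ⟨hint dx ?_, hint ds ?_, ?_⟩
  · rw [hsplit]; exact le_add_of_nonneg_right (by positivity)
  · rw [hsplit]; exact le_add_of_nonneg_left (by positivity)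
  have hμ'0 : 0 < μ' := by linarith
  have hvr : ∑ b, ‖jord (e b) (v b) (r b)‖ ^ 2 ≤ 32 / 15 * R * μ ^ 2 := by
    calc ∑ b, ‖jord (e b) (v b) (r b)‖ ^ 2 ≤ ∑ b, 2 * ((1 + β) * μ) * ‖r b‖ ^ 2 := by
          refine Finset.sum_le_sum fun b _ => (norm_jord_sq_le (he b) _ _).trans ?_
          rw [← real_inner_self_eq_norm_sq (v b)]
          gcongr
          exact ((hv b).spectrum_bounds (he b) hμ hβ0.le (hpb b)).2
      _ = 2 * ((1 + β) * μ) * ∑ b, ‖r b‖ ^ 2 := by rw [Finset.mul_sum]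
      _ ≤ 2 * ((1 + 1 / 15) * μ) * (R * μ) := by gcongr
      _ = _ := by ring
  have hjj := sum_norm_jord_sq_le he horth
  have herr : ∑ b, ‖jord (e b) (v b + dx b) (v b + ds b) - (c * μ) • e b‖ ^ 2
      ≤ (5 / 24 * β * μ) ^ 2 + 2 * (32 / 15 * R * μ ^ 2) := by
    have : ∀ b, jord (e b) (v b + dx b) (v b + ds b) - (c * μ) • e b
        = jord (e b) (dx b) (ds b) + jord (e b) (v b) (r b) := fun b =>
      jord_newton (he b) ((hv b).det_pos (he b)).ne' (hnewton b)
    simp only [this]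
    refine (sum_norm_sq_add_le _ _ one_pos).trans ?_
    have : (∑ b, ‖dx b + ds b‖ ^ 2) ^ 2 ≤ (5 / 24 * β * μ) ^ 2 := by gcongr
    linarith
  calc ∑ b, prox (e b) μ' (v b + dx b) ((2 : ℝ) • (v b + ds b))
      ≤ ∑ b, 2 / μ' ^ 2 * ‖jord (e b) (v b + dx b) (v b + ds b) - μ' • e b‖ ^ 2 :=
        Finset.sum_le_sum fun b _ => prox_two_smul_le (he b) hμ'0 _ _
    _ = 2 / μ' ^ 2 * ∑ b, ‖jord (e b) (v b + dx b) (v b + ds b) - μ' • e b‖ ^ 2 := by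
        rw [Finset.mul_sum]
    _ ≤ 2 / μ' ^ 2 * ((5 / 24 * β * μ) ^ 2 + 2 * (32 / 15 * R * μ ^ 2)) := by
        gcongr
        exact (sum_norm_jord_sub_le he _ _ hmean' (c * μ)).trans herr
    -- With `R ≤ β² / 28` the left bracket is at most `((5/24)² + 64/420) β² μ² < 0.2 β² μ²`, while
    -- the right one is `0.405 β² μ²`.
    _ ≤ 2 / μ' ^ 2 * (β ^ 2 / 2 * (9 / 10 * μ) ^ 2) := by
        gcongr
        nlinarith [mul_le_mul_of_nonneg_right hR (sq_nonneg μ), mul_nonneg (sq_nonneg β) (sq_nonneg μ)]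
    _ ≤ 2 / μ' ^ 2 * (β ^ 2 / 2 * μ' ^ 2) := by gcongr
    _ = β ^ 2 := by field_simp

end Family

/-! ### The perturbed step in the original coordinates. -/

section Step

/-- The residual in scaled coordinates. -/
theorem norm_sq_scaled_residual_le {V : Type*} [NormedAddCommGroup V] [InnerProductSpace ℝ V]
    {e : V} (he : ‖e‖ = 1) {G : V →L[ℝ] V} {D : ℝ} (hG : ∀ u v, ⟪G u, v⟫ = ⟪u, G v⟫)
    (hD : ∀ u, det e (G u) = D * det e u) {s r : V} (hs : IsInt e s) (hGs : IsInt e (G s)) :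
    (⟪e, G s⟫ - ‖G s - ⟪e, G s⟫ • e‖) ^ 2 * ‖r‖ ^ 2 ≤ 4 * ⟪e, s⟫ ^ 2 * ‖G r‖ ^ 2 := by
  refine (hGs.sq_mul_norm_sq_le he r).trans ?_
  refine le_trans (le_of_eq ?_) (hs.quad_form_le he (G r))
  -- The two quadratic forms agree: `G` is self-adjoint, and the factor `D` can be moved from `det
  -- (G s)` to `det (G r)`.
  rw [hG, hD, hD]
  ring

variable {B : Type*} [Fintype B] {V : B → Type*} [∀ b, NormedAddCommGroup (V b)]
  [∀ b, InnerProductSpace ℝ (V b)]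

theorem sum_inner_sq_le (x y : ∀ b, V b) :
    (∑ b, ⟪x b, y b⟫) ^ 2 ≤ (∑ b, ‖x b‖ ^ 2) * ∑ b, ‖y b‖ ^ 2 := by
  refine le_trans ?_ (Finset.sum_mul_sq_le_sq_mul_sq Finset.univ (fun b => ‖x b‖) fun b => ‖y b‖)
  refine sq_le_sq' ?_ ?_
  · rw [← Finset.sum_neg_distrib]
    exact Finset.sum_le_sum fun b _ => neg_le_of_abs_le (abs_real_inner_le_norm _ _)
  · exact Finset.sum_le_sum fun b _ => real_inner_le_norm _ _

/-- The hypothesis gives `7 (β² + δ²) ≤ (1 - β) β`, and the tolerance `δ / 24` is affordable because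
`2 (25/24)² ≤ 7 · 5/16`. The second bound keeps the target measure at least `901/1000` of `μ`. -/
theorem step_parameter_bounds {N β δ δ' : ℝ} (hN : 3 ≤ N) (hβ : 1 / 60 ≤ β) (hβ1 : β ≤ 1 / 15)
    (hδ : 0 < δ) (hβδ : 7 * (β ^ 2 + δ ^ 2) / (1 - β) < (1 - δ / √N) * β)
    (hδ' : |δ' - δ| ≤ δ / 24) :
    β ^ 2 + 2 * N * (δ' / √N) ^ 2 ≤ 5 / 16 * (1 - β) * β ∧ δ' / √N ≤ 99 / 1000 := by
  have hN1 : 1 ≤ √N := Real.one_le_sqrt.2 (by linarith)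
  have h1 : 7 * (β ^ 2 + δ ^ 2) ≤ (1 - β) * β := by
    have h2 : (1 - δ / √N) * β ≤ 1 * β := by
      gcongr
      linarith [show 0 ≤ δ / √N by positivity]
    have h3 := (div_lt_iff₀ (by linarith : 0 < 1 - β)).1 (hβδ.trans_le h2)
    linarith
  obtain ⟨h4, h5⟩ := abs_le.1 hδ'
  have hδ0 : 0 ≤ δ' := by linarith
  have h6 : δ' ^ 2 ≤ (25 / 24 * δ) ^ 2 := by gcongr; linarith
  have h7 : N * (δ' / √N) ^ 2 = δ' ^ 2 := by
    rw [div_pow, Real.sq_sqrt (by linarith)]; field_simp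
  constructor
  · nlinarith
  · have hsqN : 3 ≤ √N ^ 2 := by rw [Real.sq_sqrt (by linarith)]; exact hN
    have : δ ^ 2 ≤ (49 / 500) ^ 2 := by nlinarith
    have h8 : δ ≤ 49 / 500 := (abs_le_of_sq_le_sq' this (by norm_num)).2
    have h9 : 17 / 10 ≤ √N := by
      refine (abs_le_of_sq_le_sq' ?_ (by positivity)).2
      linarith
    rw [div_le_iff₀ (by linarith)]
    linarith

/-- The change of the duality measure in a perturbed step. -/
theorem perturbed_step_measure {e : ∀ b, V b} (he : ∀ b, ‖e b‖ = 1) {w x s dx ds ρ : ∀ b, V b}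
    {N μ c M : ℝ} (hcard : N = Fintype.card B) (hN : 0 < N) (hμ : 0 < μ)
    (hs : ∀ b, IsInt (e b) (s b))
    (hscal : ∀ b, x b = (1 / 2 : ℝ) • quad (e b) (w b) (s b))
    (horth : ∑ b, ⟪dx b, ds b⟫ = 0)
    (hnewton : ∀ b, dx b + (1 / 2 : ℝ) • quad (e b) (w b) (ds b)
      = (2 * (c * μ) / det (e b) (s b)) • refl (e b) (s b) - x b + ρ b)
    (hM : 0 < M) (hnorm : ∑ b, ‖s b‖ ^ 2 ≤ (2 * M) ^ 2)
    (hρ : ∑ b, ‖ρ b‖ ^ 2 ≤ (μ / (120 * N * M)) ^ 2) {μ' : ℝ}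
    (hμ' : ∑ b, ⟪x b + dx b, s b + ds b⟫ = 2 * N * μ') :
    |μ' - c * μ| ≤ μ / (120 * N ^ 2) := by
  have hinner : ∀ b, ⟪x b + dx b, s b + ds b⟫ = ⟪dx b, ds b⟫ + (2 * (c * μ) + ⟪ρ b, s b⟫) := by
    intro b
    have h1 : ⟪(1 / 2 : ℝ) • quad (e b) (w b) (ds b), s b⟫ = ⟪x b, ds b⟫ := by
      rw [hscal b, real_inner_smul_left, real_inner_smul_left, inner_quad_left, real_inner_comm]
    have h2 := congrArg (fun u => ⟪u, s b⟫) (hnewton b)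
    have hd := ((hs b).det_pos (he b)).ne'
    simp only [inner_add_left, inner_sub_left, h1] at h2
    rw [real_inner_smul_left, inner_refl_left, inner_refl_self, div_mul_cancel₀ _ hd] at h2
    simp only [inner_add_left, inner_add_right]
    linarith
  have h1 : 2 * N * (μ' - c * μ) = ∑ b, ⟪ρ b, s b⟫ := by
    rw [mul_sub, ← hμ', Finset.sum_congr rfl fun b _ => hinner b, Finset.sum_add_distrib, horth,
      Finset.sum_add_distrib]
    simp [← hcard]
    ring
  -- By Cauchy–Schwarz the error is at most `2 M · μ / (120 N M) = 2 N · μ / (120 N²)`.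
  have h2 : (2 * N * (μ' - c * μ)) ^ 2 ≤ (2 * N * (μ / (120 * N ^ 2))) ^ 2 := by
    rw [h1]
    refine (sum_inner_sq_le ρ s).trans ((mul_le_mul hρ hnorm
      (Finset.sum_nonneg fun b _ => by positivity) (by positivity)).trans_eq ?_)
    field_simp
  rw [mul_pow _ (μ' - c * μ), mul_pow _ (μ / (120 * N ^ 2))] at h2
  exact abs_le_of_sq_le_sq (le_of_mul_le_mul_left h2 (by positivity)) (by positivity)

/-- A perturbed short step for a product of Lorentz cones stays close to the central path. -/
theorem perturbed_step {e : ∀ b, V b} (he : ∀ b, ‖e b‖ = 1) {w x s dx ds ρ : ∀ b, V b}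
    {N μ β c M : ℝ} (hcard : N = Fintype.card B) (hN : 3 ≤ N) (hμ : 0 < μ)
    (hβ : 1 / 60 ≤ β) (hβ1 : β ≤ 1 / 15)
    (hc1 : β ^ 2 + 2 * N * (1 - c) ^ 2 ≤ 5 / 16 * (1 - β) * β) (hc2 : 901 / 1000 ≤ c)
    (hw : ∀ b, IsInt (e b) (w b)) (hx : ∀ b, IsInt (e b) (x b)) (hs : ∀ b, IsInt (e b) (s b))
    (hmean : ∑ b, ⟪x b, s b⟫ = 2 * N * μ)
    (hprox : ∑ b, prox (e b) μ (x b) (s b) ≤ β ^ 2)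
    (hscal : ∀ b, x b = (1 / 2 : ℝ) • quad (e b) (w b) (s b))
    (horth : ∑ b, ⟪dx b, ds b⟫ = 0)
    (hnewton : ∀ b, dx b + (1 / 2 : ℝ) • quad (e b) (w b) (ds b)
      = (2 * (c * μ) / det (e b) (s b)) • refl (e b) (s b) - x b + ρ b)
    (hM : 0 < M) (hhead : ∀ b, ⟪e b, s b⟫ ≤ M)
    (hρ : ∑ b, ‖ρ b‖ ^ 2 ≤ (μ / (120 * N * M)) ^ 2) {μ' : ℝ}
    (hμ' : ∑ b, ⟪x b + dx b, s b + ds b⟫ = 2 * N * μ')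
    (hμc : |μ' - c * μ| ≤ μ / (120 * N ^ 2)) :
    (∀ b, IsInt (e b) (x b + dx b)) ∧ (∀ b, IsInt (e b) (s b + ds b)) ∧
      ∑ b, prox (e b) μ' (x b + dx b) (s b + ds b) ≤ β ^ 2 := by
  choose G Gi D hD hGGi hGiG hGself hGdet hGrefl hGquad hGint hGiint using
    fun b => exists_scaling (he b) (hw b)
  -- The scaling relation reads `x = G² s / 2`, so `v = G⁻¹ x = G s / 2` is common to both iterates.
  have hGx : ∀ b, G b (s b) = (2 : ℝ) • Gi b (x b) := by
    intro b
    rw [hscal b, hGquad, map_smul, hGiG, smul_smul]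
    norm_num
  have hxs : ∀ b u t, ⟪Gi b u, G b t⟫ = ⟪u, t⟫ := by
    intro b u t
    rw [← hGself, hGGi]
  have hdet : ∀ b u t, det (e b) (Gi b u) * det (e b) (G b t) = det (e b) u * det (e b) t := by
    intro b u t
    conv_rhs => rw [← hGGi b u, hGdet]
    rw [hGdet]
    ring
  have hproxG : ∀ b ν u t, prox (e b) ν (Gi b u) (G b t) = prox (e b) ν u t := by
    intro b ν u t
    rw [prox, prox, hxs, hdet]
  have hvint : ∀ b, IsInt (e b) (Gi b (x b)) := fun b => hGiint b _ (hx b)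
  have hvmean : ∑ b, ⟪Gi b (x b), Gi b (x b)⟫ = Fintype.card B * μ := by
    have : ∀ b, ⟪Gi b (x b), Gi b (x b)⟫ = (1 / 2) * ⟪x b, s b⟫ := by
      intro b
      rw [← hxs b (x b) (s b), hGx, inner_smul_right]
      ring
    rw [Finset.sum_congr rfl fun b _ => this b, ← Finset.mul_sum, hmean, ← hcard]
    ring
  have hvprox : ∑ b, prox (e b) μ (Gi b (x b)) ((2 : ℝ) • Gi b (x b)) ≤ β ^ 2 := by
    simpa only [← hGx, hproxG] using hprox
  have hvnewton : ∀ b, Gi b (dx b) + (1 / 2 : ℝ) • G b (ds b)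
      = (c * μ / det (e b) (Gi b (x b))) • refl (e b) (Gi b (x b)) - Gi b (x b)
        + Gi b (ρ b) := by
    intro b
    have h1 := congrArg (Gi b) (hnewton b)
    rw [map_add, map_add, map_sub, map_smul, map_smul, hGquad, hGiG] at h1
    rw [h1]
    congr 2
    -- The Jordan inverse of `s` is `refl s / det s`. The relation `G ∘ refl ∘ G = D • refl` turns
    -- it into a multiple of `v⁻¹`.
    have h2 : Gi b (refl (e b) (s b)) = (2 / D b) • refl (e b) (Gi b (x b)) := by
      have h3 := hGrefl b (s b)
      rw [hGx, map_smul, map_smul] at h3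
      have h4 : refl (e b) (s b) = G b ((2 / D b) • refl (e b) (Gi b (x b))) := by
        rw [map_smul, div_eq_inv_mul, mul_smul, h3, smul_smul, inv_mul_cancel₀ (hD b).ne', one_smul]
      rw [h4, hGiG]
    have h5 : D b * det (e b) (s b) = 4 * det (e b) (Gi b (x b)) := by
      rw [← hGdet, hGx, det_smul]; norm_num
    have h6 := ((hs b).det_pos (he b)).ne'
    have h7 := ((hvint b).det_pos (he b)).ne'
    have h8 := (hD b).ne'
    rw [h2, smul_smul]
    congr 1
    field_simp
    linear_combination -h5
  -- The constant is `(15/14) / 360²`: `360 ≤ 120 N` comes from `N ≥ 3`, and `14/15 ≤ 1 - β`.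
  have hr : ∑ b, ‖Gi b (ρ b)‖ ^ 2 ≤ 1 / 120960 * μ := by
    have h1 : ∀ b, (1 - β) * μ * ‖Gi b (ρ b)‖ ^ 2 ≤ M ^ 2 * ‖ρ b‖ ^ 2 := by
      intro b
      have hpb := (Finset.single_le_sum
        (f := fun b => prox (e b) μ (Gi b (x b)) ((2 : ℝ) • Gi b (x b)))
        (fun b _ => (hvint b).prox_two_smul_self_nonneg (he b) μ) (Finset.mem_univ b)).trans hvprox
      have h2 := ((hvint b).spectrum_bounds (he b) hμ (by linarith) hpb).1
      have h3 := norm_sq_scaled_residual_le (he b) (hGself b) (hGdet b) (r := Gi b (ρ b)) (hs b)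
        (hGint b _ (hs b))
      have h4 : ⟪e b, G b (s b)⟫ - ‖G b (s b) - ⟪e b, G b (s b)⟫ • e b‖
          = 2 * (⟪e b, Gi b (x b)⟫ - ‖Gi b (x b) - ⟪e b, Gi b (x b)⟫ • e b‖) := by
        rw [hGx, inner_smul_right, mul_smul, ← smul_sub, norm_smul]
        norm_num
        ring
      rw [h4, hGGi] at h3
      have h5 : ⟪e b, s b⟫ ^ 2 * ‖ρ b‖ ^ 2 ≤ M ^ 2 * ‖ρ b‖ ^ 2 := by
        gcongr
        · exact (hs b).head_pos.le
        · exact hhead b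
      nlinarith [mul_le_mul_of_nonneg_right h2 (sq_nonneg ‖Gi b (ρ b)‖)]
    have h2 := Finset.sum_le_sum fun b (_ : b ∈ Finset.univ) => h1 b
    rw [← Finset.mul_sum, ← Finset.mul_sum] at h2
    have h3 : M ^ 2 * ∑ b, ‖ρ b‖ ^ 2 ≤ (μ / 360) ^ 2 := by
      calc M ^ 2 * ∑ b, ‖ρ b‖ ^ 2 ≤ M ^ 2 * (μ / (120 * N * M)) ^ 2 := by gcongr
        _ = (μ / (120 * N)) ^ 2 := by field_simp
        _ ≤ (μ / 360) ^ 2 := by gcongr; linarith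
    have h4 : 14 / 15 * μ * ∑ b, ‖Gi b (ρ b)‖ ^ 2 ≤ (1 - β) * μ * ∑ b, ‖Gi b (ρ b)‖ ^ 2 := by
      gcongr; linarith
    have h5 : μ * ∑ b, ‖Gi b (ρ b)‖ ^ 2 ≤ μ * (1 / 120960 * μ) := by nlinarith
    exact le_of_mul_le_mul_left h5 hμ
  -- For `N ≥ 3` the drift is at most `μ / 1080`, less than the spare `μ / 1000` in `c ≥ 901/1000`.
  have hμ'low : 9 / 10 * μ ≤ μ' := by
    have h1 := (abs_le.1 hμc).1
    have h2 : μ / (120 * N ^ 2) ≤ μ / 1080 := by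
      gcongr
      nlinarith
    have : 901 / 1000 * μ ≤ c * μ := by gcongr
    linarith
  have hcross : ∀ b, ⟪Gi b (x b) + Gi b (dx b), Gi b (x b) + (1 / 2 : ℝ) • G b (ds b)⟫
      = (1 / 2) * ⟪x b + dx b, s b + ds b⟫ := by
    intro b
    have : Gi b (x b) = (1 / 2 : ℝ) • G b (s b) := by rw [hGx, smul_smul]; norm_num
    rw [← map_add (Gi b), this, ← smul_add, ← map_add, inner_smul_right, hxs]
  obtain ⟨k1, k2, k3⟩ := scaled_step he (v := fun b => Gi b (x b)) (dx := fun b => Gi b (dx b))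
    (ds := fun b => (1 / 2 : ℝ) • G b (ds b)) (r := fun b => Gi b (ρ b)) (c := c) (μ' := μ')
    (R := 1 / 120960) hμ (by linarith) hβ1 hvint hvmean hvprox
    (by
      simp only [inner_smul_right, hxs]
      rw [← Finset.mul_sum, horth, mul_zero])
    hvnewton hr
    (by
      rw [← hcard]
      exact hc1)
    -- Here `β ≥ 1/60` enters: `β² / 28 ≥ 1/100800 > 1/120960`.
    (by nlinarith)
    (by
      simp only [hcross]
      rw [← Finset.mul_sum, hμ', ← hcard]
      ring)
    hμ'low
  have hsplus : ∀ b, (2 : ℝ) • (Gi b (x b) + (1 / 2 : ℝ) • G b (ds b)) = G b (s b + ds b) := by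
    intro b
    rw [map_add, hGx, smul_add, smul_smul]
    norm_num
  refine ⟨fun b => ?_, fun b => ?_, ?_⟩
  · have := hGint b _ (k1 b)
    rwa [map_add, hGGi, hGGi] at this
  · have h1 : IsInt (e b) ((2 : ℝ) • (Gi b (x b) + (1 / 2 : ℝ) • G b (ds b))) := by
      have := k2 b
      rw [isInt_iff (he b)] at this ⊢
      rw [det_smul, inner_smul_right]
      exact ⟨by linarith, by linarith⟩
    rw [hsplus] at h1
    have := hGiint b _ h1
    rwa [hGiG] at this
  · simpa only [hsplus, ← map_add, hproxG] using k3

end Step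

/-! ### Derivatives of `-log det` on one cone. -/

section Calculus

variable {V : Type*} [NormedAddCommGroup V] [InnerProductSpace ℝ V]

/-- The gradient of `-log det`. -/
def logGrad (e u : V) : V := (-(2 / det e u)) • refl e u

/-- The Hessian of `-log det`. -/
def logHess (e v : V) : V →L[ℝ] V :=
  (4 / det e v ^ 2) • (innerSL ℝ (refl e v)).smulRight (refl e v) - (2 / det e v) • refl e

theorem logHess_apply (e v u : V) : logHess e v u
    = (4 / det e v ^ 2 * ⟪refl e v, u⟫) • refl e v - (2 / det e v) • refl e u := by
  simp [logHess, smul_smul]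

variable {e : V}

theorem hasFDerivAt_det (v : V) : HasFDerivAt (det e) ((2 : ℝ) • innerSL ℝ (refl e v)) v := by
  have h := (hasFDerivAt_id (𝕜 := ℝ) v).inner ℝ (refl e).hasFDerivAt
  have h2 : (fun t : V => ⟪id t, refl e t⟫) = det e := funext fun t => inner_refl_self t
  rw [h2] at h
  refine h.congr_fderiv ?_
  ext u
  simp [fderivInnerCLM_apply, real_inner_comm u, two_mul, ← inner_refl_left v u]

theorem hasFDerivAt_neg_log_det {v : V} (hv : det e v ≠ 0) :
    HasFDerivAt (fun u => -Real.log (det e u)) (innerSL ℝ (logGrad e v)) v := by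
  refine ((hasFDerivAt_det v).log hv).neg.congr_fderiv ?_
  ext u
  simp [logGrad]
  ring

theorem hasFDerivAt_logGrad {v : V} (hv : det e v ≠ 0) :
    HasFDerivAt (logGrad e) (logHess e v) v := by
  have h1 : HasFDerivAt (fun u => -(2 / det e u))
      ((2 / det e v ^ 2) • ((2 : ℝ) • innerSL ℝ (refl e v))) v := by
    have h2 := ((hasDerivAt_inv hv).const_mul (-2 : ℝ)).comp_hasFDerivAt v (hasFDerivAt_det v)
    refine (h2.congr_fderiv ?_).congr_of_eventuallyEq (Filter.Eventually.of_forall fun u => ?_)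
    · congr 1
      ring
    · simp only [Function.comp_apply]
      ring
  refine (h1.smul (refl e).hasFDerivAt).congr_fderiv ?_
  ext u
  simp only [logHess_apply, _root_.add_apply, _root_.smul_apply,
    ContinuousLinearMap.smulRight_apply, innerSL_apply_apply, smul_eq_mul]
  module

/-- Together with `quad_logHess`, this identifies the inverse Hessian with half the quadratic
representation. -/
theorem logHess_quad (he : ‖e‖ = 1) {w : V} (hw : IsInt e w) (u : V) :
    logHess e w ((1 / 2 : ℝ) • quad e w u) = u := by
  have hd := (hw.det_pos he).ne'
  rw [logHess_apply, inner_smul_right, map_smul, inner_refl_left, quad_apply, map_sub, map_smul,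
    map_smul, refl_refl he, inner_sub_right, inner_smul_right, inner_smul_right, inner_refl_self]
  have : 4 / det e w ^ 2 * (1 / 2 * (2 * ⟪w, u⟫ * det e w - det e w * ⟪w, u⟫))
      = (2 / det e w) * (1 / 2) * (2 * ⟪w, u⟫) := by
    field_simp
    ring
  rw [this]
  have h2 : u = ((2 / det e w) * (1 / 2) * det e w) • u := by
    rw [show (2 / det e w) * (1 / 2) * det e w = 1 by field_simp, one_smul]
  conv_rhs => rw [h2]
  module

theorem quad_logHess (he : ‖e‖ = 1) {w : V} (hw : IsInt e w) (u : V) :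
    (1 / 2 : ℝ) • quad e w (logHess e w u) = u := by
  have hd := (hw.det_pos he).ne'
  rw [logHess_apply, map_sub, map_smul, map_smul, quad_apply, quad_apply, inner_refl_self,
    refl_refl he, refl_refl he, inner_refl_left]
  have h2 : u = ((2 / det e w) * (1 / 2) * det e w) • u := by
    rw [show (2 / det e w) * (1 / 2) * det e w = 1 by field_simp, one_smul]
  conv_rhs => rw [h2]
  have h3 : (4 / det e w ^ 2 * ⟪w, refl e u⟫) • ((2 * det e w) • w - det e w • w)
      = (4 / det e w * ⟪w, refl e u⟫) • w := by
    rw [← sub_smul, smul_smul]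
    congr 1
    field_simp
    ring
  rw [h3]
  module

theorem det_logGrad (he : ‖e‖ = 1) (x : V) (hx : det e x ≠ 0) :
    det e (logGrad e x) = 4 / det e x := by
  rw [logGrad, det_smul, det_refl he]
  field_simp
  ring

/-- The local norm of the deviation from the central path, in one block. -/
theorem inner_logHess_eq_prox (he : ‖e‖ = 1) {x : V} (hx : IsInt e x) (s : V) {μ : ℝ}
    (hμ : 0 < μ) :
    ⟪s + μ • logGrad e x, logHess e (-(μ • logGrad e x)) (s + μ • logGrad e x)⟫
      = prox e μ x s := by
  have hd := (hx.det_pos he).ne'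
  have hdet : det e (-(μ • logGrad e x)) = 4 * μ ^ 2 / det e x := by
    rw [← neg_smul, det_smul, det_logGrad he x hd]
    ring
  rw [logHess_apply, hdet, inner_sub_right, inner_smul_right, inner_smul_right, inner_refl_self]
  have h1 : refl e (-(μ • logGrad e x)) = (2 * μ / det e x) • x := by
    rw [logGrad, map_neg, map_smul, map_smul, refl_refl he]
    module
  have h2 : ⟪s + μ • logGrad e x, x⟫ = ⟪x, s⟫ - 2 * μ := by
    rw [inner_add_left, real_inner_smul_left, logGrad, real_inner_smul_left, inner_refl_left,
      inner_refl_self, real_inner_comm]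
    field_simp
    ring
  have h3 : det e (s + μ • logGrad e x)
      = det e s - 4 * μ / det e x * ⟪x, s⟫ + 4 * μ ^ 2 / det e x := by
    have h4 : det e (s + μ • logGrad e x)
        = det e s + 2 * ⟪μ • logGrad e x, refl e s⟫ + det e (μ • logGrad e x) := by
      rw [← inner_refl_self, ← inner_refl_self, ← inner_refl_self, map_add, inner_add_left,
        inner_add_right, inner_add_right, ← inner_refl_left s, ← inner_refl_left (μ • logGrad e x) s,
        inner_refl_left s, inner_refl_left (μ • logGrad e x) s, ← inner_refl_left s (μ • _),
        real_inner_comm (μ • logGrad e x) (refl e s)]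
      ring
    rw [h4, det_smul, det_logGrad he x hd, logGrad, real_inner_smul_left, real_inner_smul_left,
      inner_refl_refl he]
    ring
  rw [h1, real_inner_smul_left, inner_smul_right, h2, h3, real_inner_comm, h2, prox]
  field_simp
  ring

end Calculus

/-! ### Blockwise assembly of gradient, Hessian and inverse Hessian. -/

section Product

variable {B : Type*} [Fintype B] {V : B → Type*} [∀ b, NormedAddCommGroup (V b)]
  [∀ b, InnerProductSpace ℝ (V b)] {E : Type*} [NormedAddCommGroup E] [InnerProductSpace ℝ E]

/-- The blockwise map induced by a family of maps through a decomposition `Φ`. -/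
def blockMap (Φ : E ≃ₗᵢ[ℝ] PiLp 2 V) (f : ∀ b, V b → V b) (v : E) : E :=
  Φ.symm (WithLp.toLp 2 fun b => f b (Φ v b))

variable (Φ : E ≃ₗᵢ[ℝ] PiLp 2 V)

/-- The projection to a block. -/
def blockProj (b : B) : E →L[ℝ] V b :=
  PiLp.proj 2 V b ∘L (Φ.toContinuousLinearEquiv : E →L[ℝ] PiLp 2 V)

theorem blockProj_apply (b : B) (v : E) : blockProj Φ b v = Φ v b := rfl

theorem blockMap_apply (f : ∀ b, V b → V b) (v : E) (b : B) :
    Φ (blockMap Φ f v) b = f b (Φ v b) := by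
  simp [blockMap]

theorem inner_eq_sum_blocks (u v : E) : ⟪u, v⟫ = ∑ b, ⟪Φ u b, Φ v b⟫ := by
  rw [← Φ.inner_map_map, PiLp.inner_apply]

theorem hasGradientAt_sum_neg_log_det [CompleteSpace E] {e : ∀ b, V b} {v : E}
    (hv : ∀ b, det (e b) (Φ v b) ≠ 0) :
    HasGradientAt (fun u => ∑ b, -Real.log (det (e b) (Φ u b)))
      (blockMap Φ (fun b => logGrad (e b)) v) v := by
  rw [hasGradientAt_iff_hasFDerivAt]
  have h : ∀ b, HasFDerivAt (fun u => -Real.log (det (e b) (Φ u b)))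
      (innerSL ℝ (logGrad (e b) (Φ v b)) ∘L blockProj Φ b) v := fun b =>
    HasFDerivAt.comp (g := fun u => -Real.log (det (e b) u)) v
      (hasFDerivAt_neg_log_det (e := e b) (v := Φ v b) (hv b)) (blockProj Φ b).hasFDerivAt
  refine (HasFDerivAt.fun_sum fun b _ => h b).congr_fderiv ?_
  ext u
  rw [InnerProductSpace.toDual_apply_apply, inner_eq_sum_blocks Φ]
  simp [blockMap_apply, blockProj_apply]

/-- The blockwise Hessian. -/
def blockHess (e : ∀ b, V b) (v : E) : E →L[ℝ] E :=
  (Φ.symm.toContinuousLinearEquiv : PiLp 2 V →L[ℝ] E) ∘L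
    ((PiLp.continuousLinearEquiv 2 ℝ V).symm : (∀ b, V b) →L[ℝ] PiLp 2 V) ∘L
      ContinuousLinearMap.pi fun b => logHess (e b) (Φ v b) ∘L blockProj Φ b

theorem blockHess_apply (e : ∀ b, V b) (v u : E) (b : B) :
    Φ (blockHess Φ e v u) b = logHess (e b) (Φ v b) (Φ u b) := by
  simp [blockHess, blockProj_apply]

theorem hasFDerivAt_blockMap_logGrad {e : ∀ b, V b} {v : E}
    (hv : ∀ b, det (e b) (Φ v b) ≠ 0) :
    HasFDerivAt (blockMap Φ fun b => logGrad (e b)) (blockHess Φ e v) v := by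
  refine (Φ.symm.toContinuousLinearEquiv : PiLp 2 V →L[ℝ] E).hasFDerivAt.comp v ?_
  refine ((PiLp.continuousLinearEquiv 2 ℝ V).symm :
    (∀ b, V b) →L[ℝ] PiLp 2 V).hasFDerivAt.comp v ?_
  refine hasFDerivAt_pi.2 fun b => ?_
  exact HasFDerivAt.comp (g := logGrad (e b)) v (hasFDerivAt_logGrad (e := e b) (v := Φ v b) (hv b))
    (blockProj Φ b).hasFDerivAt

theorem blockHess_inverse_apply {e : ∀ b, V b} (he : ∀ b, ‖e b‖ = 1) {w : E}
    (hw : ∀ b, IsInt (e b) (Φ w b)) (u : E) (b : B) :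
    Φ ((blockHess Φ e w).inverse u) b = (1 / 2 : ℝ) • quad (e b) (Φ w b) (Φ u b) := by
  let g : E →L[ℝ] E := (Φ.symm.toContinuousLinearEquiv : PiLp 2 V →L[ℝ] E) ∘L
    ((PiLp.continuousLinearEquiv 2 ℝ V).symm : (∀ b, V b) →L[ℝ] PiLp 2 V) ∘L
      ContinuousLinearMap.pi fun b => ((1 / 2 : ℝ) • quad (e b) (Φ w b)) ∘L blockProj Φ b
  have hg : ∀ u b, Φ (g u) b = (1 / 2 : ℝ) • quad (e b) (Φ w b) (Φ u b) := by
    intro u b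
    simp [g, blockProj_apply]
  have hinv : (blockHess Φ e w).inverse = g := by
    refine ContinuousLinearMap.inverse_eq ?_ ?_
    · ext u
      refine Φ.injective ?_
      ext b : 1
      simp only [ContinuousLinearMap.comp_apply, ContinuousLinearMap.id_apply, blockHess_apply, hg,
        logHess_quad (he b) (hw b)]
    · ext u
      refine Φ.injective ?_
      ext b : 1
      simp only [ContinuousLinearMap.comp_apply, ContinuousLinearMap.id_apply, blockHess_apply, hg,
        quad_logHess (he b) (hw b)]
  rw [hinv, hg]

end Product

end Lorentz

end

/-! ### The extended cone as a product of Lorentz cones, and its barrier. -/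

noncomputable section

namespace ConicIPM

open Lorentz

variable {r m : ℕ} {p : Fin r → ℕ}

/-- The coordinates of the individual Lorentz cones of the extended cone. -/
def BlockIdx (p : Fin r → ℕ) (m : ℕ) : Fin r ⊕ (Unit ⊕ Unit) → Type
  | Sum.inl i => Fin (p i + 1)
  | Sum.inr (Sum.inl _) => Unit ⊕ Idx p
  | Sum.inr (Sum.inr _) => Unit ⊕ Fin m

instance : ∀ b, Fintype (BlockIdx p m b)
  | Sum.inl i => inferInstanceAs (Fintype (Fin (p i + 1)))
  | Sum.inr (Sum.inl _) => inferInstanceAs (Fintype (Unit ⊕ Idx p))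
  | Sum.inr (Sum.inr _) => inferInstanceAs (Fintype (Unit ⊕ Fin m))

instance : ∀ b, DecidableEq (BlockIdx p m b)
  | Sum.inl i => inferInstanceAs (DecidableEq (Fin (p i + 1)))
  | Sum.inr (Sum.inl _) => inferInstanceAs (DecidableEq (Unit ⊕ Idx p))
  | Sum.inr (Sum.inr _) => inferInstanceAs (DecidableEq (Unit ⊕ Fin m))

/-- The head coordinate of a block. -/
def headIdx (p : Fin r → ℕ) (m : ℕ) : ∀ b, BlockIdx p m b
  | Sum.inl _ => (0 : Fin _)
  | Sum.inr (Sum.inl _) => Sum.inl ()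
  | Sum.inr (Sum.inr _) => Sum.inl ()

/-- The extended coordinates grouped by blocks. -/
def blockEquiv (p : Fin r → ℕ) (m : ℕ) :
    ExtIdx p m ≃ (b : Fin r ⊕ (Unit ⊕ Unit)) × BlockIdx p m b where
  toFun
    | Sum.inl ⟨i, j⟩ => ⟨Sum.inl i, j⟩
    | Sum.inr (Sum.inl a) => ⟨Sum.inr (Sum.inl ()), a⟩
    | Sum.inr (Sum.inr a) => ⟨Sum.inr (Sum.inr ()), a⟩
  invFun
    | ⟨Sum.inl i, j⟩ => Sum.inl ⟨i, j⟩
    | ⟨Sum.inr (Sum.inl _), a⟩ => Sum.inr (Sum.inl a)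
    | ⟨Sum.inr (Sum.inr _), a⟩ => Sum.inr (Sum.inr a)
  left_inv := by rintro (⟨i, j⟩ | a | a) <;> rfl
  right_inv := by rintro ⟨i | _ | _, a⟩ <;> rfl

/-- The decomposition of the extended space into the spaces of the Lorentz cones. -/
def blocks (p : Fin r → ℕ) (m : ℕ) :
    ExtSpace p m ≃ₗᵢ[ℝ] PiLp 2 fun b => EuclideanSpace ℝ (BlockIdx p m b) :=
  (LinearIsometryEquiv.piLpCongrLeft 2 ℝ ℝ (blockEquiv p m)).trans
    (LinearIsometryEquiv.piLpCurry ℝ 2 fun _ _ => ℝ)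

/-- The axes of the Lorentz cones. -/
def axis (p : Fin r → ℕ) (m : ℕ) (b : Fin r ⊕ (Unit ⊕ Unit)) :
    EuclideanSpace ℝ (BlockIdx p m b) :=
  EuclideanSpace.single (headIdx p m b) 1

theorem norm_axis (b : Fin r ⊕ (Unit ⊕ Unit)) : ‖axis p m b‖ = 1 := by
  simp [axis]

theorem inner_axis (v : ExtSpace p m) (b : Fin r ⊕ (Unit ⊕ Unit)) :
    ⟪axis p m b, blocks p m v b⟫ = blocks p m v b (headIdx p m b) := by
  simp [axis, EuclideanSpace.inner_single_left]

theorem inner_axis_inl (v : ExtSpace p m) (i : Fin r) :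
    ⟪axis p m (Sum.inl i), blocks p m v (Sum.inl i)⟫ = head (partX v) i := inner_axis v _

theorem inner_axis_t (v : ExtSpace p m) (a : Unit) :
    ⟪axis p m (Sum.inr (Sum.inl a)), blocks p m v (Sum.inr (Sum.inl a))⟫ = partT v :=
  inner_axis v _

theorem inner_axis_tau (v : ExtSpace p m) (a : Unit) :
    ⟪axis p m (Sum.inr (Sum.inr a)), blocks p m v (Sum.inr (Sum.inr a))⟫ = partTau v :=
  inner_axis v _

theorem inner_blocks_self_inl (v : ExtSpace p m) (i : Fin r) :
    ⟪blocks p m v (Sum.inl i), blocks p m v (Sum.inl i)⟫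
      = head (partX v) i ^ 2 + ‖tail (partX v) i‖ ^ 2 := by
  rw [real_inner_self_eq_norm_sq, EuclideanSpace.real_norm_sq_eq, EuclideanSpace.real_norm_sq_eq]
  exact Fin.sum_univ_succ (fun j : Fin (p i + 1) => v (Sum.inl ⟨i, j⟩) ^ 2)

theorem inner_blocks_self_t (v : ExtSpace p m) (a : Unit) :
    ⟪blocks p m v (Sum.inr (Sum.inl a)), blocks p m v (Sum.inr (Sum.inl a))⟫
      = partT v ^ 2 + ‖partX' v‖ ^ 2 := by
  rw [real_inner_self_eq_norm_sq, EuclideanSpace.real_norm_sq_eq, EuclideanSpace.real_norm_sq_eq]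
  refine (Fintype.sum_sum_type (fun j : Unit ⊕ Idx p => v (Sum.inr (Sum.inl j)) ^ 2)).trans ?_
  simp [partT, partX']

theorem inner_blocks_self_tau (v : ExtSpace p m) (a : Unit) :
    ⟪blocks p m v (Sum.inr (Sum.inr a)), blocks p m v (Sum.inr (Sum.inr a))⟫
      = partTau v ^ 2 + ‖partX'' v‖ ^ 2 := by
  rw [real_inner_self_eq_norm_sq, EuclideanSpace.real_norm_sq_eq, EuclideanSpace.real_norm_sq_eq]
  refine (Fintype.sum_sum_type (fun j : Unit ⊕ Fin m => v (Sum.inr (Sum.inr j)) ^ 2)).trans ?_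
  simp [partTau, partX'']

theorem norm_blocks_sub_axis (v : ExtSpace p m) (b : Fin r ⊕ (Unit ⊕ Unit)) {t : ℝ} (ht : 0 ≤ t)
    (h : ⟪blocks p m v b, blocks p m v b⟫ = ⟪axis p m b, blocks p m v b⟫ ^ 2 + t ^ 2) :
    ‖blocks p m v b - ⟪axis p m b, blocks p m v b⟫ • axis p m b‖ = t := by
  have h1 := norm_sub_axis_sq (norm_axis b) (blocks p m v b)
  rw [h, add_sub_cancel_left] at h1
  exact (pow_left_inj₀ (norm_nonneg _) ht two_ne_zero).1 h1

theorem norm_sub_axis_inl (v : ExtSpace p m) (i : Fin r) :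
    ‖blocks p m v (Sum.inl i) - head (partX v) i • axis p m (Sum.inl i)‖ = ‖tail (partX v) i‖ := by
  rw [← inner_axis_inl]
  exact norm_blocks_sub_axis v _ (norm_nonneg _) (by rw [inner_blocks_self_inl, inner_axis_inl])

theorem norm_sub_axis_t (v : ExtSpace p m) (a : Unit) :
    ‖blocks p m v (Sum.inr (Sum.inl a)) - partT v • axis p m (Sum.inr (Sum.inl a))‖
      = ‖partX' v‖ := by
  rw [← inner_axis_t v a]
  exact norm_blocks_sub_axis v _ (norm_nonneg _) (by rw [inner_blocks_self_t, inner_axis_t])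

theorem norm_sub_axis_tau (v : ExtSpace p m) (a : Unit) :
    ‖blocks p m v (Sum.inr (Sum.inr a)) - partTau v • axis p m (Sum.inr (Sum.inr a))‖
      = ‖partX'' v‖ := by
  rw [← inner_axis_tau v a]
  exact norm_blocks_sub_axis v _ (norm_nonneg _) (by rw [inner_blocks_self_tau, inner_axis_tau])

theorem mem_extCone_iff (v : ExtSpace p m) : v ∈ extCone p m ↔
    ∀ b, ‖blocks p m v b - ⟪axis p m b, blocks p m v b⟫ • axis p m b‖
      ≤ ⟪axis p m b, blocks p m v b⟫ := by
  simp only [Sum.forall, norm_sub_axis_inl, norm_sub_axis_t, norm_sub_axis_tau, inner_axis_inl,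
    inner_axis_t, inner_axis_tau, forall_const]
  rfl

theorem isInt_blocks_iff (v : ExtSpace p m) : (∀ b, IsInt (axis p m b) (blocks p m v b)) ↔
    (∀ i, ‖tail (partX v) i‖ < head (partX v) i) ∧ ‖partX' v‖ < partT v ∧
      ‖partX'' v‖ < partTau v := by
  simp only [IsInt, Sum.forall, norm_sub_axis_inl, norm_sub_axis_t, norm_sub_axis_tau,
    inner_axis_inl, inner_axis_t, inner_axis_tau, forall_const]

theorem continuous_blocks (b : Fin r ⊕ (Unit ⊕ Unit)) :
    Continuous fun v : ExtSpace p m => blocks p m v b :=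
  (blockProj (blocks p m) b).continuous

theorem isOpen_isInt : IsOpen {v : ExtSpace p m | ∀ b, IsInt (axis p m b) (blocks p m v b)} := by
  simp only [Set.ofPred_forall]
  refine isOpen_iInter_of_finite fun b => ?_
  have h := continuous_blocks (p := p) (m := m) b
  exact isOpen_lt (by fun_prop) (by fun_prop)

theorem mem_interior_extCone_iff (v : ExtSpace p m) :
    v ∈ interior (extCone p m) ↔ ∀ b, IsInt (axis p m b) (blocks p m v b) := by
  constructor
  · intro h b
    set u : ExtSpace p m := (blocks p m).symm (WithLp.toLp 2 (axis p m)) with hu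
    -- Moving an interior point slightly backwards along all axes keeps it in the cone. The tails do
    -- not change, so the original inequalities are strict.
    have hc : Filter.Tendsto (fun t : ℝ => v - t • u) (nhdsWithin 0 (Set.Ioi 0)) (nhds v) := by
      have : Continuous fun t : ℝ => v - t • u := by fun_prop
      simpa using (this.tendsto 0).mono_left nhdsWithin_le_nhds
    obtain ⟨t, ht, ht0⟩ := ((hc.eventually (mem_interior_iff_mem_nhds.1 h)).and
      self_mem_nhdsWithin).exists
    have h1 := (mem_extCone_iff _).1 ht b
    have h2 : blocks p m (v - t • u) b = blocks p m v b - t • axis p m b := by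
      simp [hu]
    rw [h2, inner_sub_right, inner_smul_right, inner_self_of_norm (norm_axis b)] at h1
    have h3 : blocks p m v b - t • axis p m b - (⟪axis p m b, blocks p m v b⟫ - t * 1) • axis p m b
        = blocks p m v b - ⟪axis p m b, blocks p m v b⟫ • axis p m b := by module
    rw [h3] at h1
    have ht0' : 0 < t := ht0
    exact h1.trans_lt (by linarith)
  · intro h
    refine interior_maximal (fun u hu => ?_) isOpen_isInt h
    exact (mem_extCone_iff u).2 fun b => (hu b).le

theorem barrier_eq : (barrier : ExtSpace p m → ℝ)
    = fun v => ∑ b, -Real.log (det (axis p m b) (blocks p m v b)) := by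
  funext v
  simp only [Fintype.sum_sum_type, det, inner_blocks_self_inl, inner_blocks_self_t, inner_blocks_self_tau,
    inner_axis_inl, inner_axis_t, inner_axis_tau, barrier, Finset.univ_unique, Finset.sum_singleton,
    Finset.sum_neg_distrib]
  ring_nf

theorem grad_eq {v : ExtSpace p m} (hv : v ∈ interior (extCone p m)) :
    grad v = blockMap (blocks p m) (fun b => logGrad (axis p m b)) v := by
  rw [grad, barrier_eq]
  exact (hasGradientAt_sum_neg_log_det (blocks p m) fun b =>
    (((mem_interior_extCone_iff v).1 hv b).det_pos (norm_axis b)).ne').gradient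

theorem blocks_grad {v : ExtSpace p m} (hv : v ∈ interior (extCone p m))
    (b : Fin r ⊕ (Unit ⊕ Unit)) :
    blocks p m (grad v) b = logGrad (axis p m b) (blocks p m v b) := by
  rw [grad_eq hv, blockMap_apply]

/-- The gradient formula holds on the whole open interior, hence near `v`, and can be differentiated
there. -/
theorem hess_eq {v : ExtSpace p m} (hv : v ∈ interior (extCone p m)) :
    hess v = blockHess (blocks p m) (axis p m) v := by
  have h := hasFDerivAt_blockMap_logGrad (blocks p m) (e := axis p m) (v := v) fun b =>
    (((mem_interior_extCone_iff v).1 hv b).det_pos (norm_axis b)).ne'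
  refine (h.congr_of_eventuallyEq ?_).fderiv
  filter_upwards [isOpen_interior.mem_nhds hv] with u hu
  exact grad_eq hu

theorem localNorm_sq {x : ExtSpace p m} (hx : x ∈ interior (extCone p m)) (s : ExtSpace p m)
    {μ : ℝ} (hμ : 0 < μ) :
    ⟪s + μ • grad x, hess (-(μ • grad x)) (s + μ • grad x)⟫
      = ∑ b, prox (axis p m b) μ (blocks p m x b) (blocks p m s b) := by
  have hint := (mem_interior_extCone_iff x).1 hx
  have hneg : -(μ • grad x) ∈ interior (extCone p m) := by
    rw [mem_interior_extCone_iff]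
    intro b
    have h1 : blocks p m (-(μ • grad x)) b
        = (2 * μ / det (axis p m b) (blocks p m x b)) • refl (axis p m b) (blocks p m x b) := by
      have h2 : blocks p m (-(μ • grad x)) b = -(μ • blocks p m (grad x) b) := by simp
      rw [h2, blocks_grad hx, logGrad]
      module
    have h2 := (hint b).refl (norm_axis b)
    have h3 := (hint b).det_pos (norm_axis b)
    rw [isInt_iff (norm_axis b)] at h2 ⊢
    obtain ⟨h4, h5⟩ := h2
    rw [h1, det_smul, inner_smul_right]
    exact ⟨by positivity, by positivity⟩
  rw [hess_eq hneg, inner_eq_sum_blocks (blocks p m)]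
  refine Finset.sum_congr rfl fun b _ => ?_
  have h1 : blocks p m (s + μ • grad x) b
      = blocks p m s b + μ • logGrad (axis p m b) (blocks p m x b) := by
    rw [← blocks_grad hx]
    simp
  have h2 : blocks p m (-(μ • grad x)) b
      = -(μ • logGrad (axis p m b) (blocks p m x b)) := by
    rw [← blocks_grad hx]
    simp
  rw [blockHess_apply, h1, h2, inner_logHess_eq_prox (norm_axis b) (hint b) _ hμ]

theorem localNorm_le_iff {x : ExtSpace p m} (hx : x ∈ interior (extCone p m)) (s : ExtSpace p m)
    {μ β : ℝ} (hμ : 0 < μ) (hβ : 0 ≤ β) :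
    localNorm (-(μ • grad x)) (s + μ • grad x) ≤ β
      ↔ ∑ b, prox (axis p m b) μ (blocks p m x b) (blocks p m s b) ≤ β ^ 2 := by
  rw [localNorm, localNorm_sq hx s hμ, Real.sqrt_le_left hβ]

theorem numCones_eq_card : numCones r = Fintype.card (Fin r ⊕ (Unit ⊕ Unit)) := by
  simp [numCones]

/-! ### The duality gap and the size of the dual slack. -/

theorem inner_eq_dotProduct {ι : Type*} [Fintype ι] (x s : EuclideanSpace ℝ ι) :
    ⟪x, s⟫ = x.ofLp ⬝ᵥ s.ofLp := by
  simp [PiLp.inner_apply, dotProduct, mul_comm]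

/-- Weak duality for a primal-dual pair of linear systems. -/
theorem inner_primal_dual {ι κ : Type*} [Fintype ι] [Fintype κ] (M : Matrix κ ι ℝ)
    {x s : EuclideanSpace ℝ ι} {y : EuclideanSpace ℝ κ} {b : κ → ℝ} {c : ι → ℝ}
    (hx : M *ᵥ x.ofLp = b) (hs : Mᵀ *ᵥ y.ofLp + s.ofLp = c) :
    ⟪x, s⟫ = x.ofLp ⬝ᵥ c - b ⬝ᵥ y.ofLp := by
  rw [inner_eq_dotProduct, ← hs, dotProduct_add, ← hx, Matrix.mulVec_transpose,
    dotProduct_comm x.ofLp (Matrix.vecMul _ _), ← Matrix.dotProduct_mulVec,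
    dotProduct_comm y.ofLp (M *ᵥ x.ofLp)]
  ring

section Dual

variable {A : Matrix (Fin m) (Idx p) ℝ} {y : DualSpace p m} {s : ExtSpace p m}

theorem dual_x (h : (extMatrix A)ᵀ *ᵥ y.ofLp + s.ofLp = cost p m) (j : Idx p) :
    ∑ k, A k j * y (Sum.inl k) - y (Sum.inr (Sum.inl j)) + s (Sum.inl j) = 0 := by
  have h1 := congrFun h (Sum.inl j)
  simpa [Matrix.mulVec, dotProduct, extMatrix, cost, Matrix.one_apply, sub_eq_add_neg] using h1

theorem dual_t (h : (extMatrix A)ᵀ *ᵥ y.ofLp + s.ofLp = cost p m) :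
    y (Sum.inr (Sum.inr ())) = -partT s := by
  have h1 := congrFun h (Sum.inr (Sum.inl (Sum.inl ())))
  simp [Matrix.mulVec, dotProduct, extMatrix, cost] at h1
  exact eq_neg_of_add_eq_zero_left h1

theorem dual_x' (h : (extMatrix A)ᵀ *ᵥ y.ofLp + s.ofLp = cost p m) (j : Idx p) :
    y (Sum.inr (Sum.inl j)) = -partX' s j := by
  have h1 := congrFun h (Sum.inr (Sum.inl (Sum.inr j)))
  simp [Matrix.mulVec, dotProduct, extMatrix, cost, Matrix.one_apply] at h1
  exact eq_neg_of_add_eq_zero_left h1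

theorem dual_tau (h : (extMatrix A)ᵀ *ᵥ y.ofLp + s.ofLp = cost p m) : partTau s = 1 := by
  have h1 := congrFun h (Sum.inr (Sum.inr (Sum.inl ())))
  simp [Matrix.mulVec, dotProduct, extMatrix, cost] at h1
  exact h1

theorem dual_x'' (h : (extMatrix A)ᵀ *ᵥ y.ofLp + s.ofLp = cost p m) (k : Fin m) :
    y (Sum.inl k) = -partX'' s k := by
  have h1 := congrFun h (Sum.inr (Sum.inr (Sum.inr k)))
  simp [Matrix.mulVec, dotProduct, extMatrix, cost, Matrix.one_apply] at h1
  exact eq_neg_of_add_eq_zero_left h1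

theorem partX_eq_of_dual (h : (extMatrix A)ᵀ *ᵥ y.ofLp + s.ofLp = cost p m) :
    partX s = WithLp.toLp 2 (Aᵀ *ᵥ (partX'' s).ofLp) - partX' s := by
  ext j
  have h1 := dual_x h j
  simp only [dual_x' h, dual_x'' h, mul_neg, Finset.sum_neg_distrib] at h1
  have h2 : (Aᵀ *ᵥ (partX'' s).ofLp) j = ∑ k, A k j * partX'' s k := rfl
  have h3 : partX s j = s (Sum.inl j) := rfl
  change partX s j = (Aᵀ *ᵥ (partX'' s).ofLp) j - partX' s j
  rw [h2, h3]
  linarith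

end Dual

/-- In `cᵀ x - bᵀ y`, the cost selects `τ` and the right-hand side selects the last multiplier,
which is `-partT s`. -/
theorem inner_eq_partTau_add_partT {A : Matrix (Fin m) (Idx p) ℝ} {x s : ExtSpace p m}
    {y : DualSpace p m} (hx : extMatrix A *ᵥ x.ofLp = rhs p m)
    (hs : (extMatrix A)ᵀ *ᵥ y.ofLp + s.ofLp = cost p m) :
    ⟪x, s⟫ = partTau x + partT s := by
  rw [inner_primal_dual _ hx hs]
  have h1 : x.ofLp ⬝ᵥ cost p m = partTau x := by
    simp [dotProduct, cost, partTau]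
  have h2 : rhs p m ⬝ᵥ y.ofLp = y (Sum.inr (Sum.inr ())) := by
    simp [dotProduct, rhs]
  rw [h1, h2, dual_t hs]
  ring

theorem sum_sq_eq_one (hr : 0 < r) {A : Matrix (Fin m) (Idx p) ℝ}
    (hA : ∀ i, blockFrobenius A i = 1 / √(r : ℝ)) : ∑ k, ∑ j, A k j ^ 2 = 1 := by
  have h1 : ∀ i, ∑ k, ∑ j, A k ⟨i, j⟩ ^ 2 = 1 / (r : ℝ) := by
    intro i
    have h2 : blockFrobenius A i ^ 2 = ∑ k, ∑ j, A k ⟨i, j⟩ ^ 2 :=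
      Real.sq_sqrt (by positivity)
    rw [← h2, hA i, div_pow, Real.sq_sqrt (by positivity), one_pow]
  simp only [Fintype.sum_sigma]
  rw [Finset.sum_comm]
  simp only [h1]
  have : (r : ℝ) ≠ 0 := by positivity
  simp [this]

theorem norm_transpose_mulVec_le {ι κ : Type*} [Fintype ι] [Fintype κ] {A : Matrix κ ι ℝ}
    (hA : ∑ k, ∑ j, A k j ^ 2 = 1) (u : EuclideanSpace ℝ κ) :
    ‖(WithLp.toLp 2 (Aᵀ *ᵥ u.ofLp) : EuclideanSpace ℝ ι)‖ ≤ ‖u‖ := by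
  refine (abs_le_of_sq_le_sq' ?_ (norm_nonneg u)).2
  rw [EuclideanSpace.real_norm_sq_eq]
  calc ∑ j, (Aᵀ *ᵥ u.ofLp) j ^ 2 ≤ ∑ j, (∑ k, A k j ^ 2) * ∑ k, u k ^ 2 :=
        Finset.sum_le_sum fun j _ =>
          Finset.sum_mul_sq_le_sq_mul_sq Finset.univ (fun k => A k j) fun k => u k
    _ = ‖u‖ ^ 2 := by
        rw [← Finset.sum_mul, Finset.sum_comm, hA, one_mul, EuclideanSpace.real_norm_sq_eq]

theorem head_le_norm (x : Space p) (i : Fin r) : head x i ≤ ‖x‖ :=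
  (le_abs_self _).trans (PiLp.norm_apply_le x ⟨i, 0⟩)

theorem norm_sq_eq_parts (v : ExtSpace p m) : ‖v‖ ^ 2
    = ‖partX v‖ ^ 2 + (partT v ^ 2 + ‖partX' v‖ ^ 2) + (partTau v ^ 2 + ‖partX'' v‖ ^ 2) := by
  simp only [EuclideanSpace.real_norm_sq_eq, Fintype.sum_sum_type, Finset.univ_unique,
    Finset.sum_singleton, partX, partT, partX', partTau, partX'', add_assoc]

section Bounds

variable {A : Matrix (Fin m) (Idx p) ℝ} {x s : ExtSpace p m} {y : DualSpace p m}

/-- In `partX s = Aᵀ (partX'' s) - partX' s`, the first vector has norm at most `1` because `‖A‖_F =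
1` and `partTau s = 1`, the second at most `partT s`. -/
theorem norm_partX_le_of_dual (hr : 0 < r) (hA : ∀ i, blockFrobenius A i = 1 / √(r : ℝ))
    (hs : s ∈ interior (extCone p m)) (h : (extMatrix A)ᵀ *ᵥ y.ofLp + s.ofLp = cost p m) :
    ‖partX s‖ ≤ partT s + 1 := by
  obtain ⟨-, h1, h2⟩ := (isInt_blocks_iff s).1 ((mem_interior_extCone_iff s).1 hs)
  rw [dual_tau h] at h2
  have h3 := norm_transpose_mulVec_le (sum_sq_eq_one hr hA) (partX'' s)
  rw [partX_eq_of_dual h]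
  refine (norm_sub_le _ _).trans ?_
  linarith

theorem norm_sq_le_of_dual (hr : 0 < r) (hA : ∀ i, blockFrobenius A i = 1 / √(r : ℝ))
    (hs : s ∈ interior (extCone p m)) (h : (extMatrix A)ᵀ *ᵥ y.ofLp + s.ofLp = cost p m) :
    ‖s‖ ^ 2 ≤ (2 * (partT s + 1)) ^ 2 := by
  obtain ⟨-, h1, h2⟩ := (isInt_blocks_iff s).1 ((mem_interior_extCone_iff s).1 hs)
  have h3 := norm_partX_le_of_dual hr hA hs h
  rw [norm_sq_eq_parts, dual_tau h]
  rw [dual_tau h] at h2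
  have h4 : ‖partX s‖ ^ 2 ≤ (partT s + 1) ^ 2 := by gcongr
  have h5 : ‖partX' s‖ ^ 2 ≤ partT s ^ 2 := by gcongr
  have h6 : ‖partX'' s‖ ^ 2 ≤ 1 ^ 2 := by gcongr
  have h7 := norm_nonneg (partX' s)
  nlinarith

theorem inner_axis_le_of_dual (hr : 0 < r) (hA : ∀ i, blockFrobenius A i = 1 / √(r : ℝ))
    (hs : s ∈ interior (extCone p m)) (h : (extMatrix A)ᵀ *ᵥ y.ofLp + s.ofLp = cost p m)
    (b : Fin r ⊕ (Unit ⊕ Unit)) : ⟪axis p m b, blocks p m s b⟫ ≤ partT s + 1 := by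
  have h1 := ((isInt_blocks_iff s).1 ((mem_interior_extCone_iff s).1 hs)).2.1
  have h7 := norm_nonneg (partX' s)
  rcases b with i | a | a
  · rw [inner_axis_inl]
    exact (head_le_norm _ i).trans (norm_partX_le_of_dual hr hA hs h)
  · rw [inner_axis_t]
    linarith
  · rw [inner_axis_tau, dual_tau h]
    linarith

end Bounds

end ConicIPM

end

/-! ### The lemma. -/

open ConicIPM Lorentz

theorem lemma2p1 {r m : ℕ} (hr : 0 < r) (p : Fin r → ℕ) (hp : ∀ i, 0 < p i)
    (A : Matrix (Fin m) (ConicIPM.Idx p) ℝ)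
    (hA : ∀ i, ConicIPM.blockFrobenius A i = 1 / √(r : ℝ))
    (β δ δ' : ℝ) (hβ : 1 / 60 ≤ β) (hβ' : β ≤ 1 / 15) (hδ : 0 < δ) (hδ2 : δ < 1 / 2)
    (hβδ : 7 * (β ^ 2 + δ ^ 2) / (1 - β) < (1 - δ / √(ConicIPM.numCones r)) * β)
    (hδ' : |δ' - δ| ≤ δ / 24)
    (z : ConicIPM.Triple p m) (hz : z ∈ ConicIPM.neighborhood A β)
    (w : ConicIPM.ExtSpace p m) (hw : ConicIPM.IsScalingPoint w z.x z.s)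
    (μbar : ℝ) (hμbar : μbar = (1 - δ' / √(ConicIPM.numCones r)) * ConicIPM.mu z)
    (Δz : ConicIPM.Triple p m) (res : ConicIPM.ExtSpace p m)
    (hprimal : ConicIPM.extMatrix A *ᵥ Δz.x.ofLp = 0)
    (hdual : (ConicIPM.extMatrix A)ᵀ *ᵥ Δz.y.ofLp + Δz.s.ofLp = 0)
    (hnewton : Δz.x + (ConicIPM.hess w).inverse Δz.s
      = -(μbar • ConicIPM.grad z.s + z.x) + res)
    (hres : ‖res‖ ≤ ConicIPM.mu z /
      (120 * ConicIPM.numCones r * (2 * ConicIPM.numCones r * ConicIPM.mu z + 1))) :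
    z + Δz ∈ ConicIPM.neighborhood A β ∧
      |ConicIPM.mu (z + Δz) - μbar| ≤ ConicIPM.mu z / (120 * ConicIPM.numCones r ^ 2) := by
  obtain ⟨hxint, hsint, hprim, hdua, hnear⟩ := hz
  obtain ⟨hwint, hws⟩ := hw
  have hN : 3 ≤ numCones r := by
    have : (1 : ℝ) ≤ r := by exact_mod_cast hr
    unfold numCones
    linarith
  have hx := (mem_interior_extCone_iff _).1 hxint
  have hs := (mem_interior_extCone_iff _).1 hsint
  have hwb := (mem_interior_extCone_iff _).1 hwint
  have hgap := inner_eq_partTau_add_partT hprim hdua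
  have hτ : 0 < partTau z.x := (norm_nonneg _).trans_lt ((isInt_blocks_iff _).1 hx).2.2
  have hη : 0 < partT z.s := (norm_nonneg _).trans_lt ((isInt_blocks_iff _).1 hs).2.1
  have hmul : ⟪z.x, z.s⟫ = 2 * numCones r * mu z := by
    unfold mu
    field_simp
  have hμ : 0 < mu z := by
    have h1 : 0 < 2 * numCones r * mu z := by rw [← hmul, hgap]; positivity
    exact pos_of_mul_pos_right h1 (by linarith)
  -- The gap is `partTau z.x + partT z.s` with `partTau z.x > 0`. This explains the factor `2 (r +
  -- 2) μ + 1` in the residual tolerance.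
  have hηM : partT z.s + 1 ≤ 2 * numCones r * mu z + 1 := by linarith
  have hM : 0 < 2 * numCones r * mu z + 1 := by linarith
  obtain ⟨hc1, hc2⟩ := step_parameter_bounds hN hβ hβ' hδ hβδ hδ'
  have horth : ⟪Δz.x, Δz.s⟫ = 0 := by
    rw [inner_primal_dual _ hprimal hdual]
    simp
  have hscal : ∀ b, blocks p m z.x b
      = (1 / 2 : ℝ) • quad (axis p m b) (blocks p m w b) (blocks p m z.s b) := by
    intro b
    rw [← hws, hess_eq hwint, blockHess_apply, quad_logHess (norm_axis b) (hwb b)]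
  have hnewt : ∀ b, blocks p m Δz.x b
      + (1 / 2 : ℝ) • quad (axis p m b) (blocks p m w b) (blocks p m Δz.s b)
      = (2 * ((1 - δ' / √(numCones r)) * mu z) / det (axis p m b) (blocks p m z.s b)) •
        refl (axis p m b) (blocks p m z.s b) - blocks p m z.x b + blocks p m res b := by
    intro b
    have h1 := congrArg (fun u => blocks p m u b) hnewton
    simp only [map_add, map_neg, map_smul, PiLp.add_apply, PiLp.neg_apply, PiLp.smul_apply] at h1
    rw [hess_eq hwint, blockHess_inverse_apply (blocks p m) norm_axis hwb, blocks_grad hsint,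
      hμbar, logGrad] at h1
    rw [h1]
    module
  have hnormb : ∀ u : ExtSpace p m, ∑ b, ‖blocks p m u b‖ ^ 2 = ‖u‖ ^ 2 := by
    intro u
    rw [← real_inner_self_eq_norm_sq, inner_eq_sum_blocks (blocks p m)]
    simp only [real_inner_self_eq_norm_sq]
  have hρ : ∑ b, ‖blocks p m res b‖ ^ 2
      ≤ (mu z / (120 * numCones r * (2 * numCones r * mu z + 1))) ^ 2 := by
    rw [hnormb]
    gcongr
  have hμ' : ∑ b, ⟪blocks p m z.x b + blocks p m Δz.x b, blocks p m z.s b + blocks p m Δz.s b⟫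
      = 2 * numCones r * mu (z + Δz) := by
    have h1 : ⟪(z + Δz).x, (z + Δz).s⟫ = 2 * numCones r * mu (z + Δz) := by
      unfold mu
      field_simp
    rw [← h1, inner_eq_sum_blocks (blocks p m)]
    exact Finset.sum_congr rfl fun b _ => by
      change _ = ⟪blocks p m (z.x + Δz.x) b, blocks p m (z.s + Δz.s) b⟫
      simp only [map_add, PiLp.add_apply]
  rw [inner_eq_sum_blocks (blocks p m)] at horth hmul
  have hmu := perturbed_step_measure norm_axis numCones_eq_card (by linarith) hμ hs hscal horth
    hnewt hM ((hnormb _).trans_le ((norm_sq_le_of_dual hr hA hsint hdua).trans (by gcongr))) hρ hμ'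
  obtain ⟨k1, k2, k3⟩ := perturbed_step norm_axis numCones_eq_card hN hμ hβ hβ'
    (by rwa [sub_sub_cancel]) (by linarith) hwb hx hs hmul
    ((localNorm_le_iff hxint _ hμ (by linarith)).1 hnear) hscal horth hnewt hM
    (fun b => (inner_axis_le_of_dual hr hA hsint hdua b).trans hηM) hρ hμ' hmu
  have hx' : z.x + Δz.x ∈ interior (extCone p m) := by
    rw [mem_interior_extCone_iff]
    simpa only [map_add, PiLp.add_apply] using k1
  have hs' : z.s + Δz.s ∈ interior (extCone p m) := by
    rw [mem_interior_extCone_iff]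
    simpa only [map_add, PiLp.add_apply] using k2
  -- Positivity is needed to express the local norm at the new point through `prox`. It follows from
  -- self-duality of the cone.
  have hμpos : 0 < mu (z + Δz) := by
    have h1 : 0 < ∑ b, ⟪blocks p m z.x b + blocks p m Δz.x b,
        blocks p m z.s b + blocks p m Δz.s b⟫ :=
      Finset.sum_pos (fun b _ => (k1 b).inner_pos (norm_axis b) (k2 b)) ⟨Sum.inr (Sum.inl ()), by simp⟩
    rw [hμ'] at h1
    exact pos_of_mul_pos_right h1 (by linarith)
  refine ⟨⟨hx', hs', ?_, ?_, ?_⟩, by rw [hμbar]; exact hmu⟩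
  · change extMatrix A *ᵥ (z.x.ofLp + Δz.x.ofLp) = rhs p m
    rw [Matrix.mulVec_add, hprim, hprimal, add_zero]
  · change (extMatrix A)ᵀ *ᵥ (z.y.ofLp + Δz.y.ofLp) + (z.s.ofLp + Δz.s.ofLp) = cost p m
    rw [Matrix.mulVec_add, add_add_add_comm, hdua, hdual, add_zero]
  · refine (localNorm_le_iff hx' (z.s + Δz.s) hμpos (by linarith)).2 ?_
    simpa only [map_add, PiLp.add_apply] using k3
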